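/- Let $f(y\mid x)$, $x\in\{0,1\}$, $y\in\mathbb R$, be a memoryless binary-input output-symmetric (MBIOS) channel, i.e. $f(y\mid 0)=f(-y\mid 1)$ for all $y$, where $f(\cdot\mid x)$ is a conditional density (or a probability mass function; in general, a density with respect to a reference measure invariant under $y\mapsto -y$). Let $\lambda(x)=\sum_{i\ge1}\lambda_i x^{i-1}$ and $\rho(x)=\sum_{i\ge1}\rho_i x^{i-1}$ be the variable and check node degree distributions from the edge perspective, with $\lambda_i,\rho_i\ge 0$ and $\sum_i\lambda_i=\sum_i\rho_i=1$. The $(\lambda,\rho)$ LDPC ensemble is realized by any sequence of variable and check node degree profiles (all degrees positive, equal numbers of variable and check sockets) such that the codeword length tends to infinity and, for every $i$, the fraction of edges attached to variable (resp. check) nodes of degree $i$ tends to $\lambda_i$ (resp. $\rho_i$); given a profile, the Tanner graph is a uniformly random matching of variable sockets with check sockets. The all-zero codeword is transmitted, and sum-product decoding is performed with log-likelihood-ratio (LLR) messages in $[-\infty,+\infty]$: the initial message of a variable node is its channel LLR $\log\frac{f(y|0)}{f(y|1)}$; in each iteration, a check node sends along an edge the message $m_c$ with $\tanh\frac{m_c}{2}=\prod_i\tanh\frac{m_i}{2}$,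 the product being over the messages $m_i$ arriving on its other edges, and then a variable node sends along an edge the sum of its channel LLR and of the messages arriving on its other edges. The bit error probability of a message $M$ is $P_e(M)=\Pr(M<0)+\tfrac12\Pr(M=0)$ (a tie is decided by a fair coin). **Theorem.** For every $l\ge 0$, the bit error probability of the message sent by a variable node after $l$ iterations, averaged over the channel noise, the random graph and a uniformly random edge, converges along the ensemble to a limit $P_l$, which depends only on $l$, the channel, $\lambda$ and $\rho$. The limit $P_0$ is the uncoded bit error probability of the channel under maximum likelihood decoding (that is, $P_e$ of the channel LLR given $x=0$), and for all $l\ge 1$ $$2P_l\;\ge\;2P_0\,\lambda\bigl(1-\rho(1-2P_{l-1})\bigr).$$ -/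

import Mathlib

open scoped ENNReal NNReal

noncomputable section

namespace LDPC

/-- A memoryless binary-input output-symmetric channel with real output: conditional densities
`density x` of the output given the input bit `x`, with respect to a reference measure invariant
under `y ↦ -y`. Lebesgue measure gives the continuous case and counting measure the discrete
case. -/
structure MBIOSChannel where
  refMeasure : MeasureTheory.Measure ℝ
  refMeasure_neg : refMeasure.map (fun y => -y) = refMeasure
  density : Fin 2 → ℝ → ℝ≥0
  measurable_density : ∀ x, Measurable (density x)
  lintegral_density : ∀ x, ∫⁻ y, (density x y : ℝ≥0∞) ∂refMeasure = 1
  density_symm : ∀ y, density 0 y = density 1 (-y)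

namespace MBIOSChannel

variable (ch : MBIOSChannel)

/-- The law of one channel output when the bit `x` is sent. -/
def outputLaw (x : Fin 2) : MeasureTheory.Measure ℝ :=
  ch.refMeasure.withDensity fun y => (ch.density x y : ℝ≥0∞)

instance (x : Fin 2) : MeasureTheory.IsProbabilityMeasure (ch.outputLaw x) :=
  ⟨by rw [outputLaw, MeasureTheory.withDensity_apply _ MeasurableSet.univ,
        MeasureTheory.Measure.restrict_univ]; exact ch.lintegral_density x⟩

/-- The log-likelihood ratio `log (f(y|0) / f(y|1))`, with value `+∞` where only `f(y|1)` vanishes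
and `-∞` where only `f(y|0)` vanishes. (The value where both vanish is irrelevant, as such outputs
have probability zero.) -/
def llr (y : ℝ) : EReal :=
  ENNReal.log ((ch.density 0 y : ℝ≥0∞) / (ch.density 1 y : ℝ≥0∞))

end MBIOSChannel

/-- Probability of error when deciding the bit from the sign of a log-likelihood ratio `M`, given
that the bit `0` was sent; a tie `M = 0` is decided by a fair coin. -/
def signError {Ω : Type*} [MeasurableSpace Ω] (μ : MeasureTheory.Measure Ω) (M : Ω → EReal) : ℝ :=
  μ.real {ω | M ω < 0} + μ.real {ω | M ω = 0} / 2

/-- The uncoded bit error probability of the channel under maximum likelihood decoding. -/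
def MBIOSChannel.uncodedError (ch : MBIOSChannel) : ℝ :=
  signError (ch.outputLaw 0) ch.llr

/-- A degree distribution from the edge perspective: `coeff i` is the fraction of edges attached
to nodes of degree `i`. -/
structure DegreeDistribution where
  coeff : ℕ → ℝ
  coeff_zero : coeff 0 = 0
  coeff_nonneg : ∀ i, 0 ≤ coeff i
  hasSum_coeff : HasSum coeff 1

/-- The generating function `∑_{i ≥ 1} coeff i * x ^ (i - 1)`. -/
def DegreeDistribution.eval (L : DegreeDistribution) (x : ℝ) : ℝ :=
  ∑' i : ℕ, L.coeff i * x ^ (i - 1)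

/-- The degrees of the variable nodes and of the check nodes of a bipartite (multi)graph. -/
structure DegreeProfile where
  numVar : ℕ
  numChk : ℕ
  varDeg : Fin numVar → ℕ
  chkDeg : Fin numChk → ℕ
  varDeg_pos : ∀ v, 0 < varDeg v
  chkDeg_pos : ∀ c, 0 < chkDeg c
  sum_eq : ∑ v, varDeg v = ∑ c, chkDeg c

namespace DegreeProfile

variable (D : DegreeProfile)

/-- The sockets of the variable nodes; in a graph of the ensemble they label the edges. -/
abbrev VarSocket : Type := Σ v : Fin D.numVar, Fin (D.varDeg v)

/-- The sockets of the check nodes. -/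
abbrev ChkSocket : Type := Σ c : Fin D.numChk, Fin (D.chkDeg c)

/-- A Tanner graph with the given degrees: a matching of variable sockets with check sockets. -/
abbrev TannerGraph : Type := D.VarSocket ≃ D.ChkSocket

/-- The fraction of the edges attached to variable nodes of degree `i`. -/
def varEdgeFraction (i : ℕ) : ℝ :=
  ((Finset.univ.filter fun e : D.VarSocket => D.varDeg e.1 = i).card : ℝ) /
    (Fintype.card D.VarSocket : ℝ)

/-- The fraction of the edges attached to check nodes of degree `i`. -/
def chkEdgeFraction (i : ℕ) : ℝ :=
  ((Finset.univ.filter fun s : D.ChkSocket => D.chkDeg s.1 = i).card : ℝ) /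
    (Fintype.card D.ChkSocket : ℝ)

end DegreeProfile

/-- The profiles `D k` realize the `(L, R)` ensemble: the codeword length tends to infinity, and
the edge fractions of each degree tend to those prescribed by `L` (variable nodes) and `R` (check
nodes). -/
structure IsEnsemble (L R : DegreeDistribution) (D : ℕ → DegreeProfile) : Prop where
  length_tendsto : Filter.Tendsto (fun k => (D k).numVar) Filter.atTop Filter.atTop
  var_tendsto : ∀ i, Filter.Tendsto (fun k => (D k).varEdgeFraction i) Filter.atTop
    (nhds (L.coeff i))
  chk_tendsto : ∀ i, Filter.Tendsto (fun k => (D k).chkEdgeFraction i) Filter.atTop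
    (nhds (R.coeff i))

/-- `tanh (m / 2)` on the extended reals. -/
def tanhHalf (m : EReal) : ℝ :=
  if m = ⊤ then 1 else if m = ⊥ then -1 else Real.tanh (m.toReal / 2)

/-- The inverse of `tanhHalf` on `[-1, 1]`: `2 artanh t = log ((1 + t) / (1 - t))`. -/
def twoArtanh (t : ℝ) : EReal :=
  ENNReal.log (ENNReal.ofReal (1 + t) / ENNReal.ofReal (1 - t))

section Decoder

variable {D : DegreeProfile} (ch : MBIOSChannel) (G : D.TannerGraph)

/-- The sum-product message leaving a check node through the socket `s`, when `M e` is the message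
which the variable node sends along the edge `e`: the tanh rule over the other sockets. -/
def chkMessage (M : D.VarSocket → EReal) (s : D.ChkSocket) : EReal :=
  twoArtanh (∏ s' : D.ChkSocket with s'.1 = s.1 ∧ s' ≠ s, tanhHalf (M (G.symm s')))

/-- The sum-product message which the variable node of `e` sends along the edge `e` after `l`
iterations, when `y` is the received word: the channel log-likelihood ratio plus the incoming
messages on the other edges. -/
def varMessage (y : Fin D.numVar → ℝ) : ℕ → D.VarSocket → EReal
  | 0, e => ch.llr (y e.1)
  | l + 1, e => ch.llr (y e.1) +
      ∑ e' : D.VarSocket with e'.1 = e.1 ∧ e' ≠ e, chkMessage G (varMessage y l) (G e')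

/-- The bit error probability of the message sent by a variable node along the edge `e` after `l`
iterations, when the all-zero codeword is transmitted. -/
def edgeError (l : ℕ) (e : D.VarSocket) : ℝ :=
  signError (MeasureTheory.Measure.pi fun _ : Fin D.numVar => ch.outputLaw 0)
    fun y => varMessage ch G y l e

end Decoder

/-- The bit error probability after `l` iterations, averaged over a uniformly random Tanner graph
with degree profile `D` and a uniformly random edge. -/
def avgError (ch : MBIOSChannel) (D : DegreeProfile) (l : ℕ) : ℝ :=
  (∑ G : D.TannerGraph, ∑ e : D.VarSocket, edgeError ch G l e) /
    ((Fintype.card D.TannerGraph : ℝ) * (Fintype.card D.VarSocket : ℝ))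

end LDPC

end

/-!
Along the ensemble the neighbourhood of a random edge converges to a two-type branching process, in
which a node reached through an edge has degree `i` with probability `L.coeff i` (variable nodes)
or `R.coeff i` (check nodes). On a tree the messages arriving at a node are independent, so the
error probability of the message on an edge depends only on the shape of the tree (`treeError`,
`map_varMessage_eq_treeLaw`), and `P l` is its average over the shapes in the branching process
(`limitError`).

*Convergence.* For a fixed shape, exploring the random matching socket by socket shows that the
neighbourhood of a random edge is a tree of that shape with probability at least the branching
process probability, up to a correction that vanishes as the graph grows
(`card_isTreeOfShape_ge`). Only this lower bound is needed: the probabilities of all shapes sum to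
`1` (`hasSum_weight`), hence finitely many shapes carry almost all the mass, and the lower bounds
for the probabilities of error and of success together give the limit
(`IsEnsemble.tendsto_avgError`).

*The inequality.* The law `a` of a log-likelihood ratio given the bit `0` is symmetric, that is,
`a (-dx) = exp (-x) a (dx)`, and both node operations preserve this (`IsSymmLaw.conv`,
`IsSymmTanhLaw.mconv`). A check node multiplies independent signs, so that `1 - 2 * P` is exactly
multiplicative (`signMean_mconv`). For a symmetric law, `2 * P` is the mean of `min 1 (exp (-x))`,
which is supermultiplicative in `x`; hence at a variable node `2 * P` is at least the product of
the corresponding quantities of the summands (`IsSymmLaw.lawError_conv_ge`). Averaging these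
relations over the shapes turns the products into the generating functions of `L` and `R`
(`hasSum_list`, `limitError_succ_ge`).
-/

noncomputable section

namespace LDPC

open MeasureTheory ProbabilityTheory Filter Topology

/-! ### The functions `tanhHalf` and `twoArtanh` -/

@[simp] lemma tanhHalf_top : tanhHalf ⊤ = 1 := by simp [tanhHalf]

@[simp] lemma tanhHalf_bot : tanhHalf ⊥ = -1 := by simp [tanhHalf]

@[simp] lemma tanhHalf_coe (x : ℝ) : tanhHalf (x : EReal) = Real.tanh (x / 2) := by
  simp [tanhHalf]

lemma tanhHalf_neg (x : EReal) : tanhHalf (-x) = -tanhHalf x := by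
  induction x with
  | bot => simp
  | top => simp
  | coe x => rw [← EReal.coe_neg, tanhHalf_coe, tanhHalf_coe, neg_div, Real.tanh_neg]

lemma abs_tanhHalf_le_one (x : EReal) : |tanhHalf x| ≤ 1 := by
  induction x with
  | bot => simp
  | top => simp
  | coe x => simpa using (Real.abs_tanh_lt_one (x / 2)).le

lemma measurable_tanhHalf : Measurable tanhHalf := by
  refine EReal.measurable_of_measurable_real ?_
  simp only [tanhHalf_coe, Real.tanh_eq_sinh_div_cosh]
  fun_prop

lemma tanh_half_eq (x : ℝ) :
    Real.tanh (x / 2) = (1 - Real.exp (-x)) / (1 + Real.exp (-x)) := by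
  have h : Real.exp (-x) = Real.exp (-(x / 2)) / Real.exp (x / 2) := by
    rw [← Real.exp_sub]; congr 1; ring
  have h1 := Real.exp_pos (x / 2)
  have h2 := Real.exp_pos (-(x / 2))
  rw [Real.tanh_eq, h]
  field_simp

lemma tanhHalf_pos_iff (x : EReal) : 0 < tanhHalf x ↔ 0 < x := by
  induction x with
  | bot => simp
  | top => simp
  | coe x =>
    have h := Real.exp_pos (-x)
    rw [tanhHalf_coe, tanh_half_eq, div_pos_iff_of_pos_right (by linarith), sub_pos,
      Real.exp_lt_one_iff]
    simp

lemma tanhHalf_neg_iff (x : EReal) : tanhHalf x < 0 ↔ x < 0 := by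
  have h := tanhHalf_pos_iff (-x)
  rw [tanhHalf_neg, neg_pos] at h
  rw [h, EReal.lt_neg_comm, neg_zero]

lemma measurable_twoArtanh : Measurable twoArtanh := by
  unfold twoArtanh
  exact ENNReal.measurable_log.comp (by fun_prop)

lemma twoArtanh_neg (t : ℝ) : twoArtanh (-t) = -twoArtanh t := by
  unfold twoArtanh
  rw [← ENNReal.log_inv, ENNReal.inv_div (Or.inl ENNReal.ofReal_ne_top)]
  · simp [sub_eq_add_neg]
  · by_cases h : t < 1
    · left; simpa using h
    · right
      have : 0 < 1 + t := by linarith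
      simpa using this

lemma tanhHalf_twoArtanh {t : ℝ} (ht : |t| ≤ 1) : tanhHalf (twoArtanh t) = t := by
  obtain ⟨h1, h2⟩ := abs_le.1 ht
  unfold twoArtanh
  rcases h1.eq_or_lt with rfl | h1
  · simp
  rcases h2.eq_or_lt with rfl | h2
  · simp [ENNReal.div_zero]
  have h3 : 0 < 1 - t := by linarith
  have h4 : 0 < 1 + t := by linarith
  rw [← ENNReal.ofReal_div_of_pos h3, ENNReal.log_ofReal_of_pos (div_pos h4 h3), tanhHalf_coe,
    tanh_half_eq, Real.exp_neg, Real.exp_log (div_pos h4 h3)]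
  field_simp
  ring

/-! ### Symmetric laws of log-likelihood ratios -/

/-- The weight `min 1 (exp (-x))`. Under the law of a log-likelihood ratio given the bit `0`, it is
the density of the measure `min (f (y | 0)) (f (y | 1))` seen through the log-likelihood ratio. -/
def minWeight (x : EReal) : ℝ≥0∞ := min 1 (EReal.exp (-x))

lemma measurable_minWeight : Measurable minWeight := by
  unfold minWeight
  fun_prop

lemma minWeight_le_one (x : EReal) : minWeight x ≤ 1 := min_le_left _ _

@[simp] lemma minWeight_top : minWeight ⊤ = 0 := by simp [minWeight]

lemma minWeight_of_nonpos {x : EReal} (hx : x ≤ 0) : minWeight x = 1 := by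
  refine min_eq_left ?_
  rwa [EReal.one_le_exp_iff, EReal.le_neg, neg_zero]

lemma minWeight_coe (x : ℝ) : minWeight x = ENNReal.ofReal (Real.exp ((-x - |x|) / 2)) := by
  have h : (-x - |x|) / 2 = min 0 (-x) := by
    rcases le_total 0 x with hx | hx
    · rw [abs_of_nonneg hx, min_eq_right (by linarith)]; ring
    · rw [abs_of_nonpos hx, min_eq_left (by linarith)]; ring
  rw [minWeight, ← EReal.coe_neg, EReal.exp_coe, h, Real.exp_monotone.map_min, Real.exp_zero,
    ENNReal.ofReal_min, ENNReal.ofReal_one]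

/-- This holds without exception, as the junk value `⊤ + ⊥ = ⊥` has weight `1`. -/
lemma minWeight_mul_le (x y : EReal) : minWeight x * minWeight y ≤ minWeight (x + y) := by
  refine le_min (mul_le_one' (minWeight_le_one x) (minWeight_le_one y)) ?_
  refine (mul_le_mul' (min_le_right _ _) (min_le_right _ _)).trans ?_
  rw [← EReal.exp_add, EReal.exp_le_exp_iff]
  induction x with
  | bot => simp
  | top => simp
  | coe x =>
    induction y with
    | bot => simp
    | top => simp
    | coe y =>
      norm_cast
      linarith

/-- `1 - tanhHalf x` and `minWeight x` differ by a factor that is even in `x`, so they describe the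
same symmetry of laws. -/
lemma ofReal_one_sub_tanhHalf (x : EReal) :
    ENNReal.ofReal (1 - tanhHalf x) = minWeight x * ENNReal.ofReal (1 + |tanhHalf x|) := by
  induction x with
  | bot => rw [minWeight_of_nonpos bot_le]; norm_num
  | top => simp
  | coe x =>
    have h := Real.exp_pos (-x)
    rcases le_total x 0 with hx | hx
    · have h0 : tanhHalf (x : EReal) ≤ 0 := by
        rw [← not_lt, tanhHalf_pos_iff, not_lt]; exact_mod_cast hx
      rw [minWeight_of_nonpos (by exact_mod_cast hx), abs_of_nonpos h0, one_mul, sub_eq_add_neg]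
    · have h0 : 0 ≤ tanhHalf (x : EReal) := by
        rw [← not_lt, tanhHalf_neg_iff, not_lt]; exact_mod_cast hx
      rw [minWeight_coe, abs_of_nonneg h0, abs_of_nonneg hx,
        ← ENNReal.ofReal_mul (Real.exp_pos _).le, tanhHalf_coe, tanh_half_eq,
        show (-x - x) / 2 = -x by ring]
      congr 1
      field_simp
      ring

/-- A law of log-likelihood ratios given the bit `0` is symmetric if `a (-dx) = exp (-x) a (dx)`.
To avoid infinite densities this is stated as invariance of the measure `min 1 (exp (-x)) a (dx)`
under `x ↦ -x`, which also forces `a {⊥} = 0`. -/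
def IsSymmLaw (a : Measure EReal) : Prop :=
  ∀ g : EReal → ℝ≥0∞, Measurable g →
    ∫⁻ x, minWeight x * g (-x) ∂a = ∫⁻ x, minWeight x * g x ∂a

/-- The counterpart of `IsSymmLaw` for the laws of `tanhHalf M`, whose values lie in `[-1, 1]`. -/
def IsSymmTanhLaw (b : Measure ℝ) : Prop :=
  (∀ᵐ t ∂b, |t| ≤ 1) ∧ ∀ g : ℝ → ℝ≥0∞, Measurable g →
    ∫⁻ t, ENNReal.ofReal (1 - t) * g (-t) ∂b = ∫⁻ t, ENNReal.ofReal (1 - t) * g t ∂b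

lemma IsSymmLaw.ae_ne_bot {a : Measure EReal} (ha : IsSymmLaw a) : ∀ᵐ x ∂a, x ≠ ⊥ := by
  -- Test the symmetry on `{⊤}`, where `minWeight` vanishes.
  have h := ha (Set.indicator {⊤} 1) (measurable_one.indicator (measurableSet_singleton _))
  have h1 : ∀ x : EReal, minWeight x * Set.indicator {⊤} 1 x = 0 := by
    intro x
    by_cases hx : x = ⊤ <;> simp [hx]
  have h2 : ∀ x : EReal, minWeight x * Set.indicator {⊤} 1 (-x) = Set.indicator {⊥} 1 x := by
    intro x
    by_cases hx : x = ⊥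
    · subst hx; simp [minWeight_of_nonpos]
    · simp [hx, Set.indicator]
  simp only [h1, h2, lintegral_zero] at h
  rw [lintegral_indicator_one (measurableSet_singleton _)] at h
  simpa [ae_iff] using h

/-- The bit error probability of a message with law `a`. -/
def lawError (a : Measure EReal) : ℝ := signError a id

lemma signError_eq_lawError {Ω : Type*} [MeasurableSpace Ω] {μ : Measure Ω} {M : Ω → EReal}
    (hM : Measurable M) : signError μ M = lawError (μ.map M) := by
  unfold lawError signError
  rw [map_measureReal_apply hM (measurableSet_lt measurable_id measurable_const),
    map_measureReal_apply hM (measurableSet_eq_fun measurable_id measurable_const)]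
  rfl

/-- The bit error probability of a symmetric law is half the total mass of
`min (f (y | 0)) (f (y | 1))`. -/
lemma IsSymmLaw.ofReal_two_mul_lawError {a : Measure EReal} [IsProbabilityMeasure a]
    (ha : IsSymmLaw a) : ENNReal.ofReal (2 * lawError a) = ∫⁻ x, minWeight x ∂a := by
  have hn : MeasurableSet {x : EReal | x < 0} := measurableSet_lt measurable_id measurable_const
  have hz : MeasurableSet {x : EReal | x = 0} := measurableSet_singleton 0
  -- By symmetry the positive half-line contributes as much as the negative one.
  have h := ha (Set.indicator {x | x < 0} 1) (measurable_one.indicator hn)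
  have h1 : ∀ x : EReal, minWeight x = minWeight x * Set.indicator {x | x < 0} 1 x +
      (minWeight x * Set.indicator {x | x < 0} 1 (-x) + Set.indicator {x | x = 0} 1 x) := by
    intro x
    rcases lt_trichotomy x 0 with hx | hx | hx
    · have : ¬ (-x < 0) := by rw [EReal.neg_lt_comm, neg_zero]; exact hx.not_gt
      simp [hx, hx.ne, this]
    · simp [hx, minWeight_of_nonpos]
    · have : -x < 0 := by rwa [EReal.neg_lt_comm, neg_zero]
      simp [hx.not_gt, hx.ne', this]
  have h2 : ∀ x : EReal, minWeight x * Set.indicator {x | x < 0} 1 x =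
      Set.indicator {x | x < 0} 1 x := by
    intro x
    by_cases hx : x < 0
    · simp [hx, minWeight_of_nonpos hx.le]
    · simp [hx]
  have m1 : Measurable fun x : EReal => Set.indicator {x : EReal | x < 0} (1 : EReal → ℝ≥0∞) x :=
    measurable_one.indicator hn
  have m2 : Measurable fun x : EReal => Set.indicator {x : EReal | x = 0} (1 : EReal → ℝ≥0∞) x :=
    measurable_one.indicator hz
  have hw := measurable_minWeight
  rw [lintegral_congr h1, lintegral_add_left (by fun_prop),
    lintegral_add_right _ m2, h]
  simp only [h2]
  rw [lintegral_indicator_one hn, lintegral_indicator_one hz, lawError, signError,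
    show 2 * (a.real {ω | id ω < 0} + a.real {ω | id ω = 0} / 2) =
      a.real {x | x < 0} + (a.real {x | x < 0} + a.real {x | x = 0}) by simp only [id]; ring,
    ENNReal.ofReal_add (by positivity) (by positivity),
    ENNReal.ofReal_add (by positivity) (by positivity), ofReal_measureReal, ofReal_measureReal]

lemma lawError_nonneg (a : Measure EReal) : 0 ≤ lawError a := by
  unfold lawError signError
  positivity

lemma IsSymmLaw.two_mul_lawError_le_one {a : Measure EReal} [IsProbabilityMeasure a]
    (ha : IsSymmLaw a) : 2 * lawError a ≤ 1 := by
  rw [← ENNReal.ofReal_le_one, ha.ofReal_two_mul_lawError]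
  calc ∫⁻ x, minWeight x ∂a ≤ ∫⁻ _, 1 ∂a := lintegral_mono minWeight_le_one
    _ = 1 := by simp

lemma isSymmLaw_dirac_zero : IsSymmLaw (Measure.dirac 0) := by
  intro g hg
  rw [lintegral_dirac, lintegral_dirac]
  simp

/-- The factor by which `minWeight` fails to be multiplicative. It is invariant under
`(x, y) ↦ (-x, -y)`. -/
def minWeightDefect (x y : EReal) : ℝ≥0∞ :=
  ENNReal.ofReal (Real.exp ((|x.toReal| + |y.toReal| - |x.toReal + y.toReal|) / 2))

lemma minWeightDefect_neg (x y : EReal) : minWeightDefect (-x) (-y) = minWeightDefect x y := by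
  unfold minWeightDefect
  rw [EReal.toReal_neg_eq, EReal.toReal_neg_eq, ← neg_add, abs_neg, abs_neg, abs_neg]

lemma measurable_minWeightDefect :
    Measurable fun p : EReal × EReal => minWeightDefect p.1 p.2 := by
  unfold minWeightDefect
  fun_prop

lemma minWeight_add {x y : EReal} (hx : x ≠ ⊥) (hy : y ≠ ⊥) :
    minWeight (x + y) = minWeight x * (minWeight y * minWeightDefect x y) := by
  induction x with
  | bot => exact absurd rfl hx
  | top => simp [EReal.top_add_of_ne_bot hy]
  | coe x =>
    induction y with
    | bot => exact absurd rfl hy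
    | top => simp
    | coe y =>
      rw [← EReal.coe_add, minWeight_coe, minWeight_coe, minWeight_coe, minWeightDefect,
        ← ENNReal.ofReal_mul (Real.exp_pos _).le, ← ENNReal.ofReal_mul (Real.exp_pos _).le,
        ← Real.exp_add, ← Real.exp_add, EReal.toReal_coe, EReal.toReal_coe]
      congr 2
      ring

/-- The product of two symmetric laws, weighted by `minWeight`, is invariant under
`(x, y) ↦ (-x, -y)`. -/
lemma IsSymmLaw.lintegral_neg_neg {a b : Measure EReal} [SFinite a] [SFinite b]
    (ha : IsSymmLaw a) (hb : IsSymmLaw b) {h : EReal → EReal → ℝ≥0∞}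
    (hh : Measurable fun p : EReal × EReal => h p.1 p.2) :
    ∫⁻ x, minWeight x * ∫⁻ y, minWeight y * h (-x) (-y) ∂b ∂a =
      ∫⁻ x, minWeight x * ∫⁻ y, minWeight y * h x y ∂b ∂a := by
  have h1 : ∀ x, ∫⁻ y, minWeight y * h x (-y) ∂b = ∫⁻ y, minWeight y * h x y ∂b :=
    fun x => hb (h x) (hh.comp measurable_prodMk_left)
  have h2 : Measurable fun x => ∫⁻ y, minWeight y * h x y ∂b :=
    Measurable.lintegral_prod_right ((measurable_minWeight.comp measurable_snd).mul hh)
  rw [← ha _ h2]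
  simp only [h1]

/-- The integral form of `minWeight_add`; the exceptional sums `⊤ + ⊥` are negligible because a
symmetric law does not charge `⊥`. -/
lemma IsSymmLaw.lintegral_conv {a b : Measure EReal} [IsProbabilityMeasure a]
    [IsProbabilityMeasure b] (ha : IsSymmLaw a) (hb : IsSymmLaw b) {g : EReal → EReal → ℝ≥0∞}
    (hg : Measurable fun p : EReal × EReal => g p.1 p.2) :
    ∫⁻ x, ∫⁻ y, minWeight (x + y) * g x y ∂b ∂a =
      ∫⁻ x, minWeight x * ∫⁻ y, minWeight y * (minWeightDefect x y * g x y) ∂b ∂a := by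
  have hm : Measurable fun p : EReal × EReal =>
      minWeight p.2 * (minWeightDefect p.1 p.2 * g p.1 p.2) :=
    (measurable_minWeight.comp measurable_snd).mul (measurable_minWeightDefect.mul hg)
  refine lintegral_congr_ae ?_
  filter_upwards [ha.ae_ne_bot] with x hx
  have hmx : Measurable fun y => minWeight y * (minWeightDefect x y * g x y) :=
    hm.comp measurable_prodMk_left
  rw [← lintegral_const_mul _ hmx]
  refine lintegral_congr_ae ?_
  filter_upwards [hb.ae_ne_bot] with y hy
  rw [minWeight_add hx hy]
  simp only [mul_assoc]

/-- Combining independent observations of a bit preserves the symmetry. -/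
lemma IsSymmLaw.conv {a b : Measure EReal} [IsProbabilityMeasure a] [IsProbabilityMeasure b]
    (ha : IsSymmLaw a) (hb : IsSymmLaw b) : IsSymmLaw (a ∗ b) := by
  intro g hg
  have hg1 : Measurable fun x => minWeight x * g (-x) :=
    measurable_minWeight.mul (hg.comp measurable_neg)
  have hg2 : Measurable fun x => minWeight x * g x := measurable_minWeight.mul hg
  have ha2 : Measurable fun p : EReal × EReal => g (p.1 + p.2) :=
    hg.comp (measurable_fst.add measurable_snd)
  have hn2 : Measurable fun p : EReal × EReal => g (-p.1 + -p.2) :=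
    ha2.comp (measurable_fst.neg.prodMk measurable_snd.neg)
  have key := ha.lintegral_neg_neg hb (h := fun x y => minWeightDefect x y * g (x + y))
    (measurable_minWeightDefect.mul ha2)
  simp only [minWeightDefect_neg] at key
  have e1 := ha.lintegral_conv hb (g := fun x y => g (-x + -y)) hn2
  have e2 := ha.lintegral_conv hb (g := fun x y => g (x + y)) ha2
  rw [Measure.lintegral_conv hg1, Measure.lintegral_conv hg2, e2, ← key, ← e1]
  refine lintegral_congr_ae ?_
  filter_upwards [ha.ae_ne_bot] with x hx
  refine lintegral_congr_ae ?_
  filter_upwards [hb.ae_ne_bot] with y hy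
  rw [EReal.neg_add (Or.inl hx) (Or.inr hy), sub_eq_add_neg]

/-- The error probability of combined observations is bounded below because `minWeight` is
supermultiplicative. -/
lemma IsSymmLaw.lawError_conv_ge {a b : Measure EReal} [IsProbabilityMeasure a]
    [IsProbabilityMeasure b] (ha : IsSymmLaw a) (hb : IsSymmLaw b) :
    (2 * lawError a) * (2 * lawError b) ≤ 2 * lawError (a ∗ b) := by
  have h0 := lawError_nonneg (a ∗ b)
  have h1 := lawError_nonneg a
  have h2 := lawError_nonneg b
  rw [← ENNReal.ofReal_le_ofReal_iff (by positivity), ENNReal.ofReal_mul (by positivity),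
    ha.ofReal_two_mul_lawError, hb.ofReal_two_mul_lawError,
    (ha.conv hb).ofReal_two_mul_lawError, Measure.lintegral_conv measurable_minWeight,
    ← lintegral_mul_const _ measurable_minWeight]
  refine lintegral_mono fun x => ?_
  rw [← lintegral_const_mul _ measurable_minWeight]
  exact lintegral_mono fun y => minWeight_mul_le x y

lemma IsSymmLaw.map_tanhHalf {a : Measure EReal} (ha : IsSymmLaw a) :
    IsSymmTanhLaw (a.map tanhHalf) := by
  refine ⟨?_, fun g hg => ?_⟩
  · rw [ae_map_iff measurable_tanhHalf.aemeasurable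
      (measurableSet_le (by fun_prop) measurable_const)]
    exact Filter.Eventually.of_forall abs_tanhHalf_le_one
  · have hm := measurable_tanhHalf
    rw [lintegral_map (by fun_prop) hm, lintegral_map (by fun_prop) hm]
    have h := ha (fun x => ENNReal.ofReal (1 + |tanhHalf x|) * g (tanhHalf x)) (by fun_prop)
    simp only [tanhHalf_neg, abs_neg, ← mul_assoc, ← ofReal_one_sub_tanhHalf] at h
    exact h

lemma IsSymmTanhLaw.map_twoArtanh {b : Measure ℝ} (hb : IsSymmTanhLaw b) :
    IsSymmLaw (b.map twoArtanh) := by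
  intro g hg
  have hm := measurable_twoArtanh
  have ht := measurable_tanhHalf
  have hw := measurable_minWeight
  rw [lintegral_map (by fun_prop) hm, lintegral_map (by fun_prop) hm]
  have key : ∀ h : EReal → ℝ≥0∞, ∀ t, |t| ≤ 1 → minWeight (twoArtanh t) * h (twoArtanh t) =
      ENNReal.ofReal (1 - t) * ((ENNReal.ofReal (1 + |t|))⁻¹ * h (twoArtanh t)) := by
    intro h t ht
    have h1 := ofReal_one_sub_tanhHalf (twoArtanh t)
    rw [tanhHalf_twoArtanh ht] at h1
    have h2 : ENNReal.ofReal (1 + |t|) ≠ 0 := by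
      have := abs_nonneg t
      simp; linarith
    rw [h1, ← mul_assoc, mul_assoc (minWeight _), ENNReal.mul_inv_cancel h2 ENNReal.ofReal_ne_top,
      mul_one]
  rw [lintegral_congr_ae (hb.1.mono fun t h => key (fun x => g (-x)) t h),
    lintegral_congr_ae (hb.1.mono fun t h => key g t h)]
  have h := hb.2 (fun t => (ENNReal.ofReal (1 + |t|))⁻¹ * g (twoArtanh t)) (by fun_prop)
  simp only [twoArtanh_neg, abs_neg] at h
  exact h

lemma isSymmTanhLaw_dirac_one : IsSymmTanhLaw (Measure.dirac 1) := by
  refine ⟨?_, fun g hg => ?_⟩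
  · rw [ae_dirac_iff (measurableSet_le (by fun_prop) measurable_const)]
    simp
  · rw [lintegral_dirac, lintegral_dirac]
    simp

/-- The parity of independently observed bits is observed symmetrically. -/
lemma IsSymmTanhLaw.mconv {a b : Measure ℝ} [IsProbabilityMeasure a] [IsProbabilityMeasure b]
    (ha : IsSymmTanhLaw a) (hb : IsSymmTanhLaw b) : IsSymmTanhLaw (a ∗ₘ b) := by
  refine ⟨?_, fun g hg => ?_⟩
  · rw [Measure.mconv, ae_map_iff (by fun_prop) (measurableSet_le (by fun_prop) measurable_const)]
    refine Measure.ae_prod_iff_ae_ae ?_ |>.2 ?_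
    · exact measurableSet_le (by fun_prop) measurable_const
    filter_upwards [ha.1] with s hs
    filter_upwards [hb.1] with t ht
    rw [abs_mul]
    exact mul_le_one₀ hs (abs_nonneg t) ht
  rw [Measure.lintegral_mconv (by fun_prop), Measure.lintegral_mconv (by fun_prop)]
  -- `1 - s t` is the average of `(1 - s) (1 + t)` and `(1 + s) (1 - t)`.
  have key : ∀ h : ℝ → ℝ → ℝ≥0∞, Measurable (fun p : ℝ × ℝ => h p.1 p.2) →
      ∫⁻ s, ∫⁻ t, ENNReal.ofReal (1 - s * t) * h s t ∂b ∂a =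
        ENNReal.ofReal (1 / 2) *
          ((∫⁻ t, ENNReal.ofReal (1 + t) * ∫⁻ s, ENNReal.ofReal (1 - s) * h s t ∂a ∂b) +
          (∫⁻ s, ENNReal.ofReal (1 + s) * ∫⁻ t, ENNReal.ofReal (1 - t) * h s t ∂b ∂a)) := by
    intro h hh
    have hs : ∀ s, Measurable (h s) := fun s => hh.comp measurable_prodMk_left
    have ht : ∀ t, Measurable fun s => h s t := fun t => hh.comp measurable_prodMk_right
    have e1 : ∫⁻ t, ENNReal.ofReal (1 + t) * ∫⁻ s, ENNReal.ofReal (1 - s) * h s t ∂a ∂b =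
        ∫⁻ s, ∫⁻ t, ENNReal.ofReal (1 + t) * (ENNReal.ofReal (1 - s) * h s t) ∂b ∂a := by
      rw [lintegral_lintegral_swap (by fun_prop)]
      refine lintegral_congr fun t => ?_
      have := ht t
      rw [lintegral_const_mul _ (by fun_prop)]
    have e2 : ∀ s, ENNReal.ofReal (1 + s) * ∫⁻ t, ENNReal.ofReal (1 - t) * h s t ∂b =
        ∫⁻ t, ENNReal.ofReal (1 + s) * (ENNReal.ofReal (1 - t) * h s t) ∂b := by
      intro s
      have := hs s
      rw [lintegral_const_mul _ (by fun_prop)]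
    simp only [e1, e2]
    rw [← lintegral_add_left (Measurable.lintegral_prod_right (by fun_prop)),
      ← lintegral_const_mul _ (by
        refine Measurable.add ?_ ?_ <;> exact Measurable.lintegral_prod_right (by fun_prop))]
    refine lintegral_congr_ae ?_
    filter_upwards [ha.1] with s has
    have hs := hs s
    rw [← lintegral_add_left (by fun_prop), ← lintegral_const_mul _ (by fun_prop)]
    refine lintegral_congr_ae ?_
    filter_upwards [hb.1] with t hbt
    obtain ⟨h1, h2⟩ := abs_le.1 has
    obtain ⟨h3, h4⟩ := abs_le.1 hbt
    rw [← mul_assoc, ← mul_assoc, ← add_mul, ← mul_assoc,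
      ← ENNReal.ofReal_mul (by linarith), ← ENNReal.ofReal_mul (by linarith),
      ← ENNReal.ofReal_add (mul_nonneg (by linarith) (by linarith))
        (mul_nonneg (by linarith) (by linarith)),
      ← ENNReal.ofReal_mul (by norm_num)]
    congr 2
    ring
  rw [key (fun s t => g (-(s * t))) (by fun_prop), key (fun s t => g (s * t)) (by fun_prop)]
  congr 2
  · refine lintegral_congr fun t => ?_
    have := ha.2 (fun s => g (s * t)) (by fun_prop)
    simp only [neg_mul] at this
    rw [this]
  · refine lintegral_congr fun s => ?_
    have := hb.2 (fun t => g (s * t)) (by fun_prop)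
    simp only [mul_neg] at this
    rw [this]

/-! ### The sign of a message -/

/-- The mean of the sign under `b`. -/
def signMean (b : Measure ℝ) : ℝ := ∫ t, Real.sign t ∂b

lemma measurable_sign : Measurable Real.sign := by
  unfold Real.sign
  exact Measurable.ite (measurableSet_lt measurable_id measurable_const) measurable_const
    (Measurable.ite (measurableSet_lt measurable_const measurable_id) measurable_const
      measurable_const)

lemma sign_mul (s t : ℝ) : Real.sign (s * t) = Real.sign s * Real.sign t := by
  rcases lt_trichotomy s 0 with hs | hs | hs <;> rcases lt_trichotomy t 0 with ht | ht | ht <;>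
    simp [Real.sign_of_neg, Real.sign_of_pos, hs, ht, mul_pos_of_neg_of_neg, mul_neg_of_neg_of_pos,
      mul_neg_of_pos_of_neg]

lemma signMean_mconv (a b : Measure ℝ) [IsProbabilityMeasure a] [IsProbabilityMeasure b] :
    signMean (a ∗ₘ b) = signMean a * signMean b := by
  unfold signMean
  rw [Measure.mconv, integral_map (by fun_prop) measurable_sign.aestronglyMeasurable,
    ← integral_prod_mul]
  simp only [sign_mul]

lemma signMean_dirac_one : signMean (Measure.dirac 1) = 1 := by
  simp [signMean]

lemma signMean_map_tanhHalf (a : Measure EReal) [IsProbabilityMeasure a] :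
    signMean (a.map tanhHalf) = 1 - 2 * lawError a := by
  have hn : MeasurableSet {x : EReal | x < 0} := measurableSet_lt measurable_id measurable_const
  have hz : MeasurableSet {x : EReal | x = 0} := measurableSet_singleton 0
  have h : ∀ x, Real.sign (tanhHalf x) = 1 - ({x : EReal | x < 0}.indicator (fun _ => (2 : ℝ)) x +
      {x : EReal | x = 0}.indicator (fun _ => (1 : ℝ)) x) := by
    intro x
    rcases lt_trichotomy x 0 with hx | hx | hx
    · rw [Real.sign_of_neg ((tanhHalf_neg_iff x).2 hx)]
      simp [hx, hx.ne]; norm_num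
    · subst hx
      simp [tanhHalf]
    · rw [Real.sign_of_pos ((tanhHalf_pos_iff x).2 hx)]
      simp [hx.not_gt, hx.ne']
  unfold signMean
  rw [integral_map measurable_tanhHalf.aemeasurable measurable_sign.aestronglyMeasurable]
  simp only [h]
  have i1 : Integrable ({x : EReal | x < 0}.indicator (fun _ => (2 : ℝ))) a :=
    (integrable_const _).indicator hn
  have i2 : Integrable ({x : EReal | x = 0}.indicator (fun _ => (1 : ℝ))) a :=
    (integrable_const _).indicator hz
  have e := integral_sub (integrable_const (1 : ℝ)) (i1.add i2)
  simp only [Pi.add_apply] at e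
  rw [e, integral_add i1 i2,
    integral_indicator_const _ hn, integral_indicator_const _ hz, lawError, signError]
  simp only [integral_const, probReal_univ, smul_eq_mul, id]
  ring

lemma map_tanhHalf_map_twoArtanh {b : Measure ℝ} (hb : IsSymmTanhLaw b) :
    (b.map twoArtanh).map tanhHalf = b := by
  rw [Measure.map_map measurable_tanhHalf measurable_twoArtanh]
  conv_rhs => rw [← Measure.map_id (μ := b)]
  refine Measure.map_congr ?_
  filter_upwards [hb.1] with t ht
  exact tanhHalf_twoArtanh ht

/-! ### The law of the channel log-likelihood ratio -/

namespace MBIOSChannel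

variable (ch : MBIOSChannel)

lemma measurable_llr : Measurable ch.llr := by
  have h0 := ch.measurable_density 0
  have h1 := ch.measurable_density 1
  unfold llr
  exact ENNReal.measurable_log.comp (by fun_prop)

/-- The law of the channel log-likelihood ratio given the bit `0`. -/
def llrLaw : Measure EReal := (ch.outputLaw 0).map ch.llr

instance : IsProbabilityMeasure ch.llrLaw :=
  Measure.isProbabilityMeasure_map ch.measurable_llr.aemeasurable

lemma uncodedError_eq_lawError : ch.uncodedError = lawError ch.llrLaw :=
  signError_eq_lawError ch.measurable_llr

/-- On outputs of positive probability, `minWeight` of the log-likelihood ratio is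
`min (f (y | 0)) (f (y | 1)) / f (y | 0)`. -/
lemma density_mul_minWeight_llr (y : ℝ) : (ch.density 0 y : ℝ≥0∞) * minWeight (ch.llr y) =
    min (ch.density 0 y : ℝ≥0∞) (ch.density 1 y) := by
  by_cases h0 : ch.density 0 y = 0
  · simp [h0]
  have h0' : (ch.density 0 y : ℝ≥0∞) ≠ 0 := by simpa using h0
  rw [minWeight, llr, EReal.exp_neg, ENNReal.exp_log,
    ENNReal.inv_div (Or.inl ENNReal.coe_ne_top) (Or.inr h0'), mul_min, mul_one,
    ENNReal.mul_div_cancel h0' ENNReal.coe_ne_top]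

lemma density_one_eq (y : ℝ) : ch.density 1 y = ch.density 0 (-y) := by
  rw [ch.density_symm, neg_neg]

lemma min_density_mul_llr_neg (g : EReal → ℝ≥0∞) (y : ℝ) :
    min (ch.density 0 y : ℝ≥0∞) (ch.density 1 y) * g (-ch.llr y) =
      min (ch.density 0 (-y) : ℝ≥0∞) (ch.density 1 (-y)) * g (ch.llr (-y)) := by
  rw [← ch.density_symm, ← ch.density_one_eq, min_comm (ch.density 1 y : ℝ≥0∞)]
  by_cases h0 : ch.density 0 y = 0
  · simp [h0]
  have h0' : (ch.density 0 y : ℝ≥0∞) ≠ 0 := by simpa using h0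
  congr 2
  rw [llr, llr, ← ch.density_symm, ← ch.density_one_eq, ← ENNReal.log_inv,
    ENNReal.inv_div (Or.inl ENNReal.coe_ne_top) (Or.inr h0')]

lemma isSymmLaw_llrLaw : IsSymmLaw ch.llrLaw := by
  intro g hg
  have h0 := ch.measurable_density 0
  have h1 := ch.measurable_density 1
  have hl := ch.measurable_llr
  have hw := measurable_minWeight
  have key : ∀ h : EReal → ℝ≥0∞, Measurable h → ∫⁻ x, minWeight x * h x ∂ch.llrLaw =
      ∫⁻ y, min (ch.density 0 y : ℝ≥0∞) (ch.density 1 y) * h (ch.llr y) ∂ch.refMeasure := by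
    intro h hh
    rw [llrLaw, lintegral_map (by fun_prop) hl, outputLaw,
      lintegral_withDensity_eq_lintegral_mul _ (by fun_prop) (by fun_prop)]
    refine lintegral_congr fun y => ?_
    rw [Pi.mul_apply, ← mul_assoc, density_mul_minWeight_llr]
  rw [key (fun x => g (-x)) (by fun_prop), key g hg]
  simp only [min_density_mul_llr_neg]
  conv_rhs => rw [← ch.refMeasure_neg]
  rw [lintegral_map (by fun_prop) measurable_neg]

end MBIOSChannel

/-! ### Shapes of neighbourhoods -/

/-- The shape of a rooted tree explored to depth `k`: at positive depth, the list of the shapes of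
the subtrees. At depth `0` nothing is known. -/
def Shape : ℕ → Type
  | 0 => Unit
  | k + 1 => List (Shape k)

namespace Shape

/-- The number of nodes explored. -/
def size : ∀ k, Shape k → ℕ
  | 0, _ => 0
  | k + 1, (τ : List (Shape k)) => 1 + (τ.map (size k)).sum

/-- The probability of a shape in a branching process in which `w true` and `w false` are the
degree distributions, from the edge perspective, of the variable and the check nodes; the root is
a variable node if `b = true`. -/
def weight (w : Bool → ℕ → ℝ) : Bool → ∀ k, Shape k → ℝ
  | _, 0, _ => 1
  | b, k + 1, (τ : List (Shape k)) => w b (τ.length + 1) * (τ.map (weight w (!b) k)).prod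

lemma size_succ {k : ℕ} (τ : Shape (k + 1)) : size (k + 1) τ = 1 + (List.map (size k) τ).sum :=
  rfl

lemma weight_succ (w : Bool → ℕ → ℝ) (b : Bool) {k : ℕ} (τ : Shape (k + 1)) :
    weight w b (k + 1) τ = w b (List.length τ + 1) * (List.map (weight w (!b) k) τ).prod :=
  rfl

lemma weight_nonneg {w : Bool → ℕ → ℝ} (hw : ∀ b n, 0 ≤ w b n) (b : Bool) (k : ℕ) (τ : Shape k) :
    0 ≤ weight w b k τ := by
  induction k generalizing b with
  | zero => exact zero_le_one
  | succ k ih =>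
    refine mul_nonneg (hw _ _) (List.prod_nonneg fun x hx => ?_)
    obtain ⟨c, -, rfl⟩ := List.mem_map.1 hx
    exact ih _ _

lemma tendsto_weight {w : ℕ → Bool → ℕ → ℝ} {w' : Bool → ℕ → ℝ}
    (h : ∀ b n, Filter.Tendsto (fun j => w j b n) Filter.atTop (nhds (w' b n)))
    (b : Bool) (k : ℕ) (τ : Shape k) :
    Filter.Tendsto (fun j => weight (w j) b k τ) Filter.atTop (nhds (weight w' b k τ)) := by
  induction k generalizing b with
  | zero => exact tendsto_const_nhds
  | succ k ih =>
    exact (h _ _).mul (tendsto_list_prod (α := ℕ) (f := fun c j => weight (w j) (!b) k c)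
      (a := weight w' (!b) k) τ fun c _ => ih (!b) c)

end Shape

/-! ### Exploring a Tanner graph -/

namespace DegreeProfile

variable (D : DegreeProfile)

/-- The sockets of all nodes. -/
abbrev Dart : Type := D.VarSocket ⊕ D.ChkSocket

/-- The variable nodes and the check nodes. -/
abbrev Node : Type := Fin D.numVar ⊕ Fin D.numChk

/-- The node of a socket. -/
def node : D.Dart → D.Node := Sum.map Sigma.fst Sigma.fst

/-- The degree of a node. -/
def deg : D.Node → ℕ := Sum.elim D.varDeg D.chkDeg

/-- The other sockets of the node of a socket. -/
def others : D.Dart → List D.Dart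
  | .inl e => (Finset.univ.filter fun e' : D.VarSocket => e'.1 = e.1 ∧ e' ≠ e).toList.map .inl
  | .inr s => (Finset.univ.filter fun s' : D.ChkSocket => s'.1 = s.1 ∧ s' ≠ s).toList.map .inr

/-- The fraction of the edges attached to nodes of degree `n`, which are variable nodes if
`b = true` and check nodes otherwise. -/
def edgeFraction (b : Bool) (n : ℕ) : ℝ :=
  if b then D.varEdgeFraction n else D.chkEdgeFraction n

/-- The number of edges. -/
def numEdges : ℕ := Fintype.card D.VarSocket

variable {D}

@[simp] lemma node_inl (e : D.VarSocket) : D.node (.inl e) = .inl e.1 := rfl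

@[simp] lemma node_inr (s : D.ChkSocket) : D.node (.inr s) = .inr s.1 := rfl

@[simp] lemma deg_inl (v : Fin D.numVar) : D.deg (.inl v) = D.varDeg v := rfl

@[simp] lemma deg_inr (c : Fin D.numChk) : D.deg (.inr c) = D.chkDeg c := rfl

lemma card_chkSocket : Fintype.card D.ChkSocket = D.numEdges := by
  simp [numEdges, D.sum_eq]

lemma mem_others {d d' : D.Dart} : d' ∈ D.others d ↔ D.node d' = D.node d ∧ d' ≠ d := by
  rcases d with e | s <;> rcases d' with e' | s' <;> simp [others]

lemma nodup_others (d : D.Dart) : (D.others d).Nodup := by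
  rcases d with e | s
  · exact (Finset.nodup_toList _).map Sum.inl_injective
  · exact (Finset.nodup_toList _).map Sum.inr_injective

lemma isLeft_eq_of_node_eq {d d' : D.Dart} (h : D.node d' = D.node d) : d'.isLeft = d.isLeft := by
  rcases d with e | s <;> rcases d' with e' | s' <;> simp_all [node]

lemma card_sigma_fst_eq {ι : Type*} [Fintype ι] [DecidableEq ι] (f : ι → ℕ) (i : ι) :
    (Finset.univ.filter fun x : Σ i, Fin (f i) => x.1 = i).card = f i := by
  have : (Finset.univ.filter fun x : Σ i, Fin (f i) => x.1 = i) =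
      Finset.univ.map (Function.Embedding.sigmaMk i) := by
    ext ⟨j, a⟩
    simp only [Finset.mem_filter, Finset.mem_univ, true_and, Finset.mem_map,
      Function.Embedding.sigmaMk_apply]
    constructor
    · rintro rfl
      exact ⟨a, rfl⟩
    · rintro ⟨b, hb⟩
      exact (congrArg Sigma.fst hb).symm
  rw [this, Finset.card_map, Finset.card_univ, Fintype.card_fin]

lemma length_others (d : D.Dart) : (D.others d).length + 1 = D.deg (D.node d) := by
  have key : ∀ {ι : Type} [Fintype ι] [DecidableEq ι] (f : ι → ℕ) (x : Σ i, Fin (f i)),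
      (Finset.univ.filter fun y : Σ i, Fin (f i) => y.1 = x.1 ∧ y ≠ x).card + 1 = f x.1 := by
    intro ι _ _ f x
    have : (Finset.univ.filter fun y : Σ i, Fin (f i) => y.1 = x.1 ∧ y ≠ x) =
        (Finset.univ.filter fun y : Σ i, Fin (f i) => y.1 = x.1).erase x := by
      ext y
      simp [and_comm]
    rw [this, Finset.card_erase_add_one (by simp), card_sigma_fst_eq]
  rcases d with e | s
  · simpa [others] using key D.varDeg e
  · simpa [others] using key D.chkDeg s

lemma card_node_eq_le (u : D.Node) :
    (Finset.univ.filter fun x : D.Dart => D.node x = u).card ≤ D.deg u := by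
  rcases u with v | c
  · have : (Finset.univ.filter fun x : D.Dart => D.node x = .inl v) =
        (Finset.univ.filter fun x : D.VarSocket => x.1 = v).map .inl := by
      ext x
      rcases x with e | s <;> simp
    rw [this, Finset.card_map, card_sigma_fst_eq]
    rfl
  · have : (Finset.univ.filter fun x : D.Dart => D.node x = .inr c) =
        (Finset.univ.filter fun x : D.ChkSocket => x.1 = c).map .inr := by
      ext x
      rcases x with e | s <;> simp
    rw [this, Finset.card_map, card_sigma_fst_eq]
    rfl

lemma edgeFraction_nonneg (b : Bool) (n : ℕ) : 0 ≤ D.edgeFraction b n := by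
  unfold edgeFraction varEdgeFraction chkEdgeFraction
  split_ifs <;> positivity

lemma card_dart_eq (hN : 0 < D.numEdges) (b : Bool) (n : ℕ) :
    ((Finset.univ.filter fun x : D.Dart => x.isLeft = b ∧ D.deg (D.node x) = n).card : ℝ) =
      D.numEdges * D.edgeFraction b n := by
  have hN' : (D.numEdges : ℝ) ≠ 0 := by positivity
  cases b
  · have : (Finset.univ.filter fun x : D.Dart => x.isLeft = false ∧ D.deg (D.node x) = n) =
        (Finset.univ.filter fun x : D.ChkSocket => D.chkDeg x.1 = n).map .inr := by
      ext x
      rcases x with e | s <;> simp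
    rw [this, Finset.card_map, edgeFraction, if_neg (by simp), chkEdgeFraction, card_chkSocket,
      mul_div_cancel₀ _ hN']
  · have : (Finset.univ.filter fun x : D.Dart => x.isLeft = true ∧ D.deg (D.node x) = n) =
        (Finset.univ.filter fun x : D.VarSocket => D.varDeg x.1 = n).map .inl := by
      ext x
      rcases x with e | s <;> simp
    rw [this, Finset.card_map, edgeFraction, if_pos rfl, varEdgeFraction,
      ← numEdges, mul_div_cancel₀ _ hN']

open Classical in
/-- Lower bound for the number of sockets of degree `n` on one side that avoid the nodes `U`. -/
lemma card_fresh_ge (hN : 0 < D.numEdges) (U : List D.Node) (b : Bool) (n : ℕ) :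
    (D.numEdges * D.edgeFraction b n - U.length * n : ℝ) ≤
      ((Finset.univ.filter fun x : D.Dart =>
        (x.isLeft = b ∧ D.deg (D.node x) = n) ∧ D.node x ∉ U).card : ℝ) := by
  have h1 : (Finset.univ.filter fun x : D.Dart =>
      (x.isLeft = b ∧ D.deg (D.node x) = n) ∧ D.node x ∈ U).card ≤ U.length * n := by
    calc _ ≤ ((U.toFinset.filter fun u => D.deg u = n).biUnion fun u =>
          Finset.univ.filter fun x : D.Dart => D.node x = u).card := by
          refine Finset.card_le_card fun x hx => ?_
          simp only [Finset.mem_filter, Finset.mem_univ, true_and] at hx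
          simp [hx]
      _ ≤ ∑ u ∈ U.toFinset.filter fun u => D.deg u = n,
          (Finset.univ.filter fun x : D.Dart => D.node x = u).card := Finset.card_biUnion_le
      _ ≤ ∑ u ∈ U.toFinset.filter fun u => D.deg u = n, n := by
          refine Finset.sum_le_sum fun u hu => ?_
          rw [← (Finset.mem_filter.1 hu).2]
          exact card_node_eq_le u
      _ ≤ U.length * n := by
          rw [Finset.sum_const, smul_eq_mul]
          exact Nat.mul_le_mul_right _
            ((Finset.card_filter_le _ _).trans (List.toFinset_card_le U))
  have h2 := Finset.card_filter_add_card_filter_not (s := Finset.univ.filter fun x : D.Dart =>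
    x.isLeft = b ∧ D.deg (D.node x) = n) (fun x => D.node x ∈ U)
  rw [Finset.filter_filter, Finset.filter_filter] at h2
  have h3 := card_dart_eq hN b n
  rw [← h3, ← h2]
  have h1' := (Nat.cast_le (α := ℝ)).2 h1
  push_cast at h1' ⊢
  linarith

variable (G : D.TannerGraph)

/-- The socket matched with a given one. -/
def opp : D.Dart → D.Dart
  | .inl e => .inr (G e)
  | .inr s => .inl (G.symm s)

/-- The shape of the depth `k` neighbourhood entered through a socket, when the walk never turns
back. -/
def exploreShape : ∀ k, D.Dart → Shape k
  | 0, _ => ()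
  | k + 1, d => (D.others d).map fun d' => exploreShape k (opp G d')

/-- The nodes visited when exploring the depth `k` neighbourhood entered through a socket. The
neighbourhood is a tree if there are no repetitions. -/
def exploreNodes : ℕ → D.Dart → List D.Node
  | 0, _ => []
  | k + 1, d => D.node d :: (D.others d).flatMap fun d' => exploreNodes k (opp G d')

/-! ### Probability of a shape in the random graph -/

/-- The graph contains the matched pairs in `p`. -/
def Extends (p : List (D.Dart × D.Dart)) : Prop := ∀ q ∈ p, opp G q.1 = q.2

/-- The sockets occurring in a list of pairs. -/
def darts (p : List (D.Dart × D.Dart)) : List D.Dart := p.map Prod.fst ++ p.map Prod.snd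

open Classical in
/-- The number of graphs with a property. -/
def graphCount (Q : D.TannerGraph → Prop) : ℕ := (Finset.univ.filter Q).card

open Classical in
lemma graphCount_mono {Q Q' : D.TannerGraph → Prop} (h : ∀ G, Q G → Q' G) :
    graphCount Q ≤ graphCount Q' :=
  Finset.card_le_card (Finset.monotone_filter_right _ fun G _ => h G)

/-- Conditionally on the matched pairs `p`, an unmatched socket is matched with a given unmatched
socket of the other side with probability at least `1 / numEdges`: a transposition turns any graph
that contains `p` into one that also contains the new pair. -/
lemma graphCount_extends_le {p : List (D.Dart × D.Dart)} {d x : D.Dart}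
    (hdx : x.isLeft = !d.isLeft) (hd : d ∉ darts p) (hx : x ∉ darts p) :
    graphCount (fun G : D.TannerGraph => Extends G p) ≤
      D.numEdges * graphCount (fun G : D.TannerGraph => Extends G ((d, x) :: p)) := by
  classical
  have key : ∀ (e : D.VarSocket) (s : D.ChkSocket), Sum.inl e ∉ darts p → Sum.inr s ∉ darts p →
      graphCount (fun G : D.TannerGraph => Extends G p) ≤
        D.numEdges * graphCount (fun G : D.TannerGraph => G e = s ∧ Extends G p) := by
    intro e s he hs
    rw [← card_chkSocket, ← Finset.card_univ, graphCount, graphCount, ← Finset.card_product]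
    refine Finset.card_le_card_of_injOn (fun G => (G e, G.trans (Equiv.swap s (G e)))) ?_ ?_
    · intro G hG
      simp only [Finset.coe_filter, Finset.mem_univ, true_and, Set.mem_ofPred_eq] at hG
      simp only [Finset.coe_product, Set.mem_prod, Finset.coe_univ, Set.mem_univ, true_and,
        Finset.coe_filter, Finset.mem_univ, Set.mem_ofPred_eq]
      refine ⟨by simp, ?_⟩
      rintro ⟨a, b⟩ hab
      have hG' := hG _ hab
      have ha : a ∈ darts p := List.mem_append_left _ (List.mem_map_of_mem (f := Prod.fst) hab)
      have hb : b ∈ darts p := List.mem_append_right _ (List.mem_map_of_mem (f := Prod.snd) hab)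
      rcases a with e' | s' <;> rcases b with e'' | s'' <;> simp only [opp, reduceCtorEq,
        Sum.inl.injEq, Sum.inr.injEq] at hG' ⊢
      · rw [Equiv.trans_apply, hG', Equiv.swap_apply_of_ne_of_ne]
        · rintro rfl; exact hs hb
        · intro h
          rw [← hG', G.apply_eq_iff_eq] at h
          subst h; exact he ha
      · rw [Equiv.symm_trans_apply, Equiv.symm_swap, Equiv.swap_apply_of_ne_of_ne, hG']
        · rintro rfl; exact hs ha
        · intro h
          rw [h, Equiv.symm_apply_apply] at hG'
          subst hG'; exact he hb
    · intro G _ G' _ h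
      simp only [Prod.mk.injEq] at h
      obtain ⟨h1, h2⟩ := h
      rw [h1] at h2
      ext1 a
      have := congrArg (fun F : D.TannerGraph => F a) h2
      simpa using this
  rcases d with e | s <;> rcases x with e' | s' <;> simp only [Sum.isLeft_inl, Sum.isLeft_inr,
    Bool.not_true, Bool.not_false, reduceCtorEq] at hdx
  · refine (key e s' hd hx).trans (Nat.mul_le_mul_left _ (graphCount_mono ?_))
    rintro G ⟨h1, h2⟩
    simpa [Extends, opp, h1] using h2
  · refine (key e' s hx hd).trans (Nat.mul_le_mul_left _ (graphCount_mono ?_))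
    rintro G ⟨h1, h2⟩
    simpa [Extends, opp, ← h1] using h2

end DegreeProfile

namespace DegreeProfile

variable {D : DegreeProfile}

/-- The state of an exploration: the nodes `U` have been visited, the pairs `p` have been revealed,
the sockets `ds` of visited nodes are to be followed, and at most `m` more nodes are to be visited,
for a total of at most `K`. -/
structure Frontier (K : ℕ) (U : List D.Node) (p : List (D.Dart × D.Dart)) (ds : List D.Dart)
    (m : ℕ) : Prop where
  nodup_darts : (ds ++ darts p).Nodup
  node_mem : ∀ d ∈ ds ++ darts p, D.node d ∈ U
  nodup_nodes : U.Nodup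
  length_add_le : U.length + m ≤ K

lemma Frontier.reveal {K : ℕ} {U : List D.Node} {p : List (D.Dart × D.Dart)} {d x : D.Dart}
    {l₁ l₂ : List D.Dart} {m : ℕ} (h : Frontier K U p (d :: (l₁ ++ l₂)) (1 + m))
    (hx : D.node x ∉ U) :
    Frontier K (D.node x :: U) ((d, x) :: p) (l₁ ++ (D.others x ++ l₂)) m := by
  have hperm : (l₁ ++ (D.others x ++ l₂) ++ darts ((d, x) :: p)).Perm
      ((D.others x ++ [x]) ++ (d :: (l₁ ++ l₂) ++ darts p)) := by
    rw [← Multiset.coe_eq_coe]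
    simp only [darts, List.map_cons, ← Multiset.coe_add, ← Multiset.cons_coe,
      ← Multiset.singleton_add, Multiset.coe_nil]
    abel
  have hnode : ∀ y ∈ D.others x ++ [x], D.node y = D.node x := by
    intro y hy
    rcases List.mem_append.1 hy with hy | hy
    · exact (mem_others.1 hy).1
    · rw [List.mem_singleton.1 hy]
  refine ⟨?_, ?_, List.nodup_cons.2 ⟨hx, h.nodup_nodes⟩, ?_⟩
  · rw [hperm.nodup_iff, List.nodup_append]
    refine ⟨?_, h.nodup_darts, ?_⟩
    · rw [List.nodup_append]
      refine ⟨nodup_others x, List.nodup_singleton x, ?_⟩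
      rintro a ha b hb rfl
      exact (mem_others.1 ha).2 (List.mem_singleton.1 hb)
    · rintro a ha b hb rfl
      exact hx (hnode a ha ▸ h.node_mem a hb)
  · intro y hy
    rcases List.mem_append.1 (hperm.mem_iff.1 hy) with hy | hy
    · rw [hnode y hy]
      exact List.mem_cons_self
    · exact List.mem_cons_of_mem _ (h.node_mem y hy)
  · have := h.length_add_le
    rw [List.length_cons]
    omega

/-- The total size of the shapes required in a list of tasks. -/
def taskSize {k : ℕ} (ts : List (D.Dart × Shape k)) : ℕ := (ts.map fun t => Shape.size k t.2).sum

/-- The probability that all tasks succeed in a branching process. -/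
def taskWeight (w : Bool → ℕ → ℝ) {k : ℕ} (ts : List (D.Dart × Shape k)) : ℝ :=
  (ts.map fun t => Shape.weight w (!t.1.isLeft) k t.2).prod

/-- Across each socket of the list the graph has the required shape. -/
def HasShapes (G : D.TannerGraph) {k : ℕ} (ts : List (D.Dart × Shape k)) : Prop :=
  ∀ t ∈ ts, exploreShape G k (opp G t.1) = t.2

/-- The nodes visited across the sockets of the list. -/
def taskNodes (G : D.TannerGraph) {k : ℕ} (ts : List (D.Dart × Shape k)) : List D.Node :=
  ts.flatMap fun t => exploreNodes G k (opp G t.1)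

/-- The tasks created by the arrival at the socket `x`, when the shape `τ` is required there. -/
def childTasks (x : D.Dart) {k : ℕ} (τ : Shape (k + 1)) : List (D.Dart × Shape k) :=
  (D.others x).zip τ

section childTasks

variable {x : D.Dart} {k : ℕ} {τ : Shape (k + 1)}

lemma map_fst_childTasks (h : D.deg (D.node x) = List.length τ + 1) :
    (childTasks x τ).map Prod.fst = D.others x := by
  refine List.map_fst_zip ?_
  have := length_others x
  omega

lemma map_snd_childTasks (h : D.deg (D.node x) = List.length τ + 1) :
    (childTasks x τ).map Prod.snd = τ := by
  refine List.map_snd_zip ?_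
  have := length_others x
  omega

lemma one_add_taskSize_childTasks (h : D.deg (D.node x) = List.length τ + 1) :
    1 + taskSize (childTasks x τ) = Shape.size (k + 1) τ := by
  have := congrArg (fun l => (l.map (Shape.size k)).sum) (map_snd_childTasks h)
  rw [List.map_map] at this
  rw [Shape.size_succ, ← this]
  rfl

lemma isLeft_of_mem_childTasks {t : D.Dart × Shape k} (ht : t ∈ childTasks x τ) :
    t.1.isLeft = x.isLeft :=
  isLeft_eq_of_node_eq (mem_others.1 (List.of_mem_zip (a := t.1) (b := t.2) ht).1).1

lemma taskWeight_childTasks (w : Bool → ℕ → ℝ) (h : D.deg (D.node x) = List.length τ + 1) :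
    taskWeight w (childTasks x τ) = (List.map (Shape.weight w (!x.isLeft) k) τ).prod := by
  conv_rhs => rw [← map_snd_childTasks h, List.map_map]
  refine congrArg List.prod (List.map_congr_left fun t ht => ?_)
  rw [isLeft_of_mem_childTasks ht]
  rfl

lemma HasShapes.exploreShape_eq {G : D.TannerGraph} (h : D.deg (D.node x) = List.length τ + 1)
    (hG : HasShapes G (childTasks x τ)) : exploreShape G (k + 1) x = τ := by
  conv_rhs => rw [← map_snd_childTasks h]
  rw [exploreShape]
  conv_lhs => rw [← map_fst_childTasks h, List.map_map]
  exact List.map_congr_left fun t ht => hG t ht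

lemma exploreNodes_eq_taskNodes (G : D.TannerGraph) (h : D.deg (D.node x) = List.length τ + 1) :
    exploreNodes G (k + 1) x = D.node x :: taskNodes G (childTasks x τ) := by
  rw [exploreNodes, ← map_fst_childTasks h, List.flatMap_map]
  rfl

end childTasks

/-- Lower bounds for the degree distributions seen by an exploration that avoids up to `K` nodes:
the avoided nodes of degree `n` have at most `K * n` sockets. -/
def reducedFraction (D : DegreeProfile) (K : ℕ) (b : Bool) (n : ℕ) : ℝ :=
  max 0 (D.edgeFraction b n - K * n / D.numEdges)

lemma reducedFraction_nonneg (K : ℕ) (b : Bool) (n : ℕ) : 0 ≤ D.reducedFraction K b n :=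
  le_max_left _ _

lemma reducedFraction_le (K : ℕ) (b : Bool) (n : ℕ) :
    D.reducedFraction K b n ≤ D.edgeFraction b n :=
  max_le (edgeFraction_nonneg b n) (sub_le_self _ (by positivity))

lemma taskWeight_nonneg (K : ℕ) {k : ℕ} (ts : List (D.Dart × Shape k)) :
    0 ≤ taskWeight (D.reducedFraction K) ts := by
  refine List.prod_nonneg fun y hy => ?_
  obtain ⟨t, -, rfl⟩ := List.mem_map.1 hy
  exact Shape.weight_nonneg (reducedFraction_nonneg K) _ _ _

/-- Revealing the partner `x` of the pending socket `d`: at least the fraction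
`reducedFraction K (!d.isLeft) n` of the possible partners have degree `n` and belong to nodes not
yet visited, and each is the actual partner with conditional probability at least
`1 / numEdges`. -/
lemma graphCount_reveal_ge (hN : 0 < D.numEdges) {K : ℕ} {U : List D.Node}
    {p : List (D.Dart × D.Dart)} {d : D.Dart} {ds : List D.Dart} {m : ℕ}
    (hF : Frontier K U p (d :: ds) m) (n : ℕ) {Q : D.TannerGraph → Prop} {θ : ℝ} (hθ : 0 ≤ θ)
    (hQ : ∀ x : D.Dart, x.isLeft = (!d.isLeft) → D.deg (D.node x) = n → D.node x ∉ U →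
      (graphCount (fun G : D.TannerGraph => Extends G ((d, x) :: p)) : ℝ) * θ ≤
        graphCount fun G : D.TannerGraph => opp G d = x ∧ Q G) :
    (graphCount (fun G : D.TannerGraph => Extends G p) : ℝ) *
      (D.reducedFraction K (!d.isLeft) n * θ) ≤ graphCount Q := by
  classical
  set good : Finset D.Dart := Finset.univ.filter fun x : D.Dart =>
    (x.isLeft = (!d.isLeft) ∧ D.deg (D.node x) = n) ∧ D.node x ∉ U with hgood
  have hN' : (0 : ℝ) < D.numEdges := by exact_mod_cast hN
  set c : ℝ := (graphCount (fun G : D.TannerGraph => Extends G p) : ℝ) with hc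
  have hc0 : 0 ≤ c := Nat.cast_nonneg _
  have hd : d ∉ darts p := by
    have := hF.nodup_darts
    rw [List.cons_append, List.nodup_cons] at this
    exact fun h => this.1 (List.mem_append_right _ h)
  have hcard : D.numEdges * D.reducedFraction K (!d.isLeft) n ≤ (good.card : ℝ) := by
    rw [reducedFraction, mul_max_of_nonneg _ _ hN'.le, mul_zero]
    refine max_le (Nat.cast_nonneg _) (le_trans ?_ (card_fresh_ge hN U (!d.isLeft) n))
    rw [mul_sub, mul_div_cancel₀ _ hN'.ne']
    have h1 : (U.length : ℝ) ≤ K := by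
      have := hF.length_add_le
      exact_mod_cast (by omega : U.length ≤ K)
    have h2 : (U.length : ℝ) * n ≤ K * n := by gcongr
    linarith
  have hx : ∀ x ∈ good, c / D.numEdges * θ ≤
      graphCount fun G : D.TannerGraph => opp G d = x ∧ Q G := by
    intro x hx
    simp only [hgood, Finset.mem_filter, Finset.mem_univ, true_and] at hx
    refine le_trans ?_ (hQ x hx.1.1 hx.1.2 hx.2)
    refine mul_le_mul_of_nonneg_right ?_ hθ
    rw [div_le_iff₀ hN', mul_comm]
    have hxp : x ∉ darts p := fun h => hx.2 (hF.node_mem x (List.mem_append_right _ h))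
    rw [hc]
    exact_mod_cast graphCount_extends_le hx.1.1 hd hxp
  have hsum : (∑ x ∈ good, graphCount fun G : D.TannerGraph => opp G d = x ∧ Q G) ≤
      graphCount Q := by
    unfold graphCount
    rw [← Finset.card_biUnion]
    · refine Finset.card_le_card fun G hG => ?_
      simp only [Finset.mem_biUnion, Finset.mem_filter, Finset.mem_univ, true_and] at hG ⊢
      obtain ⟨x, -, -, h⟩ := hG
      exact h
    · intro x _ y _ hxy
      rw [Function.onFun, Finset.disjoint_left]
      intro G hG hG'
      simp only [Finset.mem_filter, Finset.mem_univ, true_and] at hG hG'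
      exact hxy (hG.1.symm.trans hG'.1)
  calc c * (D.reducedFraction K (!d.isLeft) n * θ)
      = (D.numEdges * D.reducedFraction K (!d.isLeft) n) * (c / D.numEdges * θ) := by
        field_simp
    _ ≤ good.card * (c / D.numEdges * θ) := by gcongr
    _ = ∑ x ∈ good, c / D.numEdges * θ := by rw [Finset.sum_const, nsmul_eq_mul]
    _ ≤ ∑ x ∈ good, (graphCount fun G : D.TannerGraph => opp G d = x ∧ Q G : ℝ) :=
        Finset.sum_le_sum hx
    _ ≤ graphCount Q := by exact_mod_cast hsum

/-- Exploring level by level: the tasks `ts` belong to the current level and the tasks `ds` to the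
next one. -/
lemma graphCount_step_ge (hN : 0 < D.numEdges) {K k : ℕ}
    (ih : ∀ (ds : List (D.Dart × Shape k)) (U : List D.Node) (p : List (D.Dart × D.Dart)),
      Frontier K U p (ds.map Prod.fst) (taskSize ds) →
      (graphCount (fun G : D.TannerGraph => Extends G p) : ℝ) *
          taskWeight (D.reducedFraction K) ds ≤
        graphCount fun G : D.TannerGraph =>
          Extends G p ∧ HasShapes G ds ∧ (U ++ taskNodes G ds).Nodup)
    (ts : List (D.Dart × Shape (k + 1))) :
    ∀ (ds : List (D.Dart × Shape k)) (U : List D.Node) (p : List (D.Dart × D.Dart)),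
      Frontier K U p (ts.map Prod.fst ++ ds.map Prod.fst) (taskSize ts + taskSize ds) →
      (graphCount (fun G : D.TannerGraph => Extends G p) : ℝ) *
          (taskWeight (D.reducedFraction K) ts * taskWeight (D.reducedFraction K) ds) ≤
        graphCount fun G : D.TannerGraph => Extends G p ∧ (HasShapes G ts ∧ HasShapes G ds) ∧
          (U ++ (taskNodes G ts ++ taskNodes G ds)).Nodup := by
  induction ts with
  | nil =>
    intro ds U p hF
    simpa [taskSize, taskWeight, HasShapes, taskNodes] using
      ih ds U p (by simpa [taskSize] using hF)
  | cons t ts iht =>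
    intro ds U p hF
    obtain ⟨d, τ⟩ := t
    set θ : ℝ := taskWeight (D.reducedFraction K) ts *
      ((List.map (Shape.weight (D.reducedFraction K) d.isLeft k) τ).prod *
        taskWeight (D.reducedFraction K) ds) with hθ
    have hθ0 : 0 ≤ θ := by
      refine mul_nonneg (taskWeight_nonneg _ _) (mul_nonneg ?_ (taskWeight_nonneg _ _))
      refine List.prod_nonneg fun y hy => ?_
      obtain ⟨t, -, rfl⟩ := List.mem_map.1 hy
      exact Shape.weight_nonneg (reducedFraction_nonneg K) _ _ _
    have hw : taskWeight (D.reducedFraction K) ((d, τ) :: ts) *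
        taskWeight (D.reducedFraction K) ds =
        D.reducedFraction K (!d.isLeft) (List.length τ + 1) * θ := by
      rw [hθ]
      simp only [taskWeight, List.map_cons, List.prod_cons, Shape.weight_succ, Bool.not_not]
      ring
    rw [hw]
    refine graphCount_reveal_ge hN hF _ hθ0 ?_
    intro x hxl hxd hxU
    have hsize : taskSize ((d, τ) :: ts) + taskSize ds =
        1 + (taskSize ts + taskSize (childTasks x τ ++ ds)) := by
      have := one_add_taskSize_childTasks hxd
      simp only [taskSize, List.map_cons, List.sum_cons, List.map_append, List.sum_append] at this ⊢
      omega
    rw [hsize] at hF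
    have hF' := hF.reveal (x := x) (l₁ := ts.map Prod.fst) (l₂ := ds.map Prod.fst) hxU
    rw [← map_fst_childTasks hxd, ← List.map_append] at hF'
    have hmain := iht (childTasks x τ ++ ds) (D.node x :: U) ((d, x) :: p) hF'
    have hw' : taskWeight (D.reducedFraction K) ts *
        taskWeight (D.reducedFraction K) (childTasks x τ ++ ds) = θ := by
      have := taskWeight_childTasks (D.reducedFraction K) hxd
      rw [hxl, Bool.not_not] at this
      rw [hθ, ← this]
      simp [taskWeight]
    rw [hw'] at hmain
    refine hmain.trans (Nat.cast_le.2 (graphCount_mono ?_))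
    rintro G ⟨hp, ⟨hs1, hs2⟩, hnd⟩
    have hdx : opp G d = x := hp (d, x) List.mem_cons_self
    have hsx : HasShapes G (childTasks x τ) := fun t ht => hs2 t (List.mem_append_left _ ht)
    refine ⟨hdx, fun q hq => hp q (List.mem_cons_of_mem _ hq), ⟨?_, ?_⟩, ?_⟩
    · intro t ht
      rcases List.mem_cons.1 ht with rfl | ht
      · change exploreShape G (k + 1) (opp G d) = τ
        rw [hdx]
        exact hsx.exploreShape_eq hxd
      · exact hs1 t ht
    · exact fun t ht => hs2 t (List.mem_append_right _ ht)
    · have hperm : (U ++ (taskNodes G ((d, τ) :: ts) ++ taskNodes G ds)).Perm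
          (D.node x :: U ++ (taskNodes G ts ++ taskNodes G (childTasks x τ ++ ds))) := by
        have : taskNodes G ((d, τ) :: ts) =
            (D.node x :: taskNodes G (childTasks x τ)) ++ taskNodes G ts := by
          rw [← exploreNodes_eq_taskNodes G hxd, ← hdx]
          rfl
        rw [this, ← Multiset.coe_eq_coe]
        have : taskNodes G (childTasks x τ ++ ds) =
            taskNodes G (childTasks x τ) ++ taskNodes G ds := by
          simp [taskNodes]
        rw [this]
        simp only [← Multiset.coe_add, ← Multiset.cons_coe, ← Multiset.singleton_add]
        abel
      exact hperm.nodup_iff.2 hnd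

/-- Given the revealed pairs `p`, the pending sockets lead to disjoint trees of the required shapes
that avoid the visited nodes with at least the branching process probability. -/
lemma graphCount_hasShapes_ge (hN : 0 < D.numEdges) {K : ℕ} (k : ℕ) :
    ∀ (ds : List (D.Dart × Shape k)) (U : List D.Node) (p : List (D.Dart × D.Dart)),
      Frontier K U p (ds.map Prod.fst) (taskSize ds) →
      (graphCount (fun G : D.TannerGraph => Extends G p) : ℝ) *
          taskWeight (D.reducedFraction K) ds ≤
        graphCount fun G : D.TannerGraph =>
          Extends G p ∧ HasShapes G ds ∧ (U ++ taskNodes G ds).Nodup := by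
  induction k with
  | zero =>
    intro ds U p hF
    have : taskWeight (D.reducedFraction K) ds = 1 :=
      List.prod_eq_one fun y hy => by
        obtain ⟨t, -, rfl⟩ := List.mem_map.1 hy
        rfl
    rw [this, mul_one]
    refine Nat.cast_le.2 (graphCount_mono fun G hG => ⟨hG, fun t _ => rfl, ?_⟩)
    have h0 : taskNodes G ds = [] := List.flatMap_eq_nil_iff.2 fun t _ => rfl
    rw [h0, List.append_nil]
    exact hF.nodup_nodes
  | succ k ih =>
    intro ds U p hF
    simpa [taskSize, taskWeight, HasShapes, taskNodes] using
      graphCount_step_ge hN ih ds [] U p (by simpa [taskSize] using hF)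

/-- The neighbourhood of an edge entered through its variable node is a tree of shape `τ`. -/
def IsTreeOfShape (G : D.TannerGraph) {k : ℕ} (τ : Shape k) (e : D.VarSocket) : Prop :=
  exploreShape G k (.inl e) = τ ∧ (exploreNodes G k (.inl e)).Nodup

open Classical in
/-- The probability that the neighbourhood of a random edge is a tree of shape `τ` is at least
the branching process probability, up to a correction that vanishes as the graph grows. -/
lemma card_isTreeOfShape_ge (hN : 0 < D.numEdges) {k K : ℕ} (τ : Shape (k + 1))
    (hK : Shape.size (k + 1) τ ≤ K) :
    (Fintype.card D.TannerGraph * Fintype.card D.VarSocket : ℝ) *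
        Shape.weight (D.reducedFraction K) true (k + 1) τ ≤
      ∑ e : D.VarSocket, (graphCount fun G : D.TannerGraph => IsTreeOfShape G τ e : ℝ) := by
  have hN' : (0 : ℝ) < D.numEdges := by exact_mod_cast hN
  set S : Finset D.VarSocket :=
    Finset.univ.filter fun e : D.VarSocket => D.varDeg e.1 = List.length τ + 1 with hS
  set θ : ℝ := (List.map (Shape.weight (D.reducedFraction K) false k) τ).prod with hθ
  have hθ0 : 0 ≤ θ := by
    refine List.prod_nonneg fun y hy => ?_
    obtain ⟨t, -, rfl⟩ := List.mem_map.1 hy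
    exact Shape.weight_nonneg (reducedFraction_nonneg K) _ _ _
  have he : ∀ e ∈ S, (Fintype.card D.TannerGraph : ℝ) * θ ≤
      graphCount fun G : D.TannerGraph => IsTreeOfShape G τ e := by
    intro e he
    have hd : D.deg (D.node (.inl e)) = List.length τ + 1 := (Finset.mem_filter.1 he).2
    have hF : Frontier K [D.node (.inl e)] [] ((childTasks (.inl e) τ).map Prod.fst)
        (taskSize (childTasks (.inl e) τ)) := by
      rw [map_fst_childTasks hd]
      refine ⟨by simpa [darts] using nodup_others (D := D) (.inl e), ?_, List.nodup_singleton _, ?_⟩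
      · intro d hd
        simp only [darts, List.map_nil, List.append_nil] at hd
        rw [(mem_others.1 hd).1]
        exact List.mem_singleton_self _
      · rw [List.length_singleton, one_add_taskSize_childTasks hd]
        exact hK
    have hmain := graphCount_hasShapes_ge hN k _ _ _ hF
    rw [taskWeight_childTasks _ hd] at hmain
    have h1 : graphCount (fun G : D.TannerGraph => Extends G []) = Fintype.card D.TannerGraph := by
      simp [graphCount, Extends]
    rw [h1] at hmain
    refine hmain.trans (Nat.cast_le.2 (graphCount_mono ?_))
    rintro G ⟨-, hs, hnd⟩
    refine ⟨hs.exploreShape_eq hd, ?_⟩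
    rw [exploreNodes_eq_taskNodes G hd]
    exact hnd
  have hcard : (Fintype.card D.VarSocket : ℝ) * D.reducedFraction K true (List.length τ + 1) ≤
      S.card := by
    calc _ ≤ (D.numEdges : ℝ) * D.edgeFraction true (List.length τ + 1) :=
          mul_le_mul_of_nonneg_left (reducedFraction_le K true _) hN'.le
      _ = S.card := by
          rw [edgeFraction, if_pos rfl, varEdgeFraction, ← numEdges, mul_div_cancel₀ _ hN'.ne']
  calc _ = (Fintype.card D.TannerGraph : ℝ) * θ *
        (Fintype.card D.VarSocket * D.reducedFraction K true (List.length τ + 1)) := by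
        rw [Shape.weight_succ, hθ, Bool.not_true]
        ring
    _ ≤ (Fintype.card D.TannerGraph : ℝ) * θ * S.card := by gcongr
    _ = ∑ e ∈ S, (Fintype.card D.TannerGraph : ℝ) * θ := by
        rw [Finset.sum_const, nsmul_eq_mul, mul_comm]
    _ ≤ ∑ e ∈ S, (graphCount fun G : D.TannerGraph => IsTreeOfShape G τ e : ℝ) :=
        Finset.sum_le_sum he
    _ ≤ _ := Finset.sum_le_sum_of_subset_of_nonneg (Finset.subset_univ _)
        fun _ _ _ => Nat.cast_nonneg _

end DegreeProfile

/-! ### Sums and products of independent random variables -/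

section Independence

/-- A function of the coordinates in `S` factors measurably through the restriction to `S`. -/
lemma exists_eq_comp_restrict_of_dependsOn {ι E : Type*} [MeasurableSpace E]
    {X : (ι → ℝ) → E} {S : Finset ι} (hX : Measurable X) (hXS : DependsOn X S) :
    ∃ φ : (S → ℝ) → E, Measurable φ ∧ X = φ ∘ fun y i => y i := by
  classical
  refine ⟨fun z => X fun i => if h : i ∈ S then z ⟨i, h⟩ else 0, hX.comp ?_, ?_⟩
  · refine measurable_pi_lambda _ fun i => ?_
    by_cases h : i ∈ S
    · simp only [h, dite_true]
      exact measurable_pi_apply _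
    · simp only [h, dite_false]
      exact measurable_const
  · funext y
    refine hXS fun i hi => ?_
    simp [Finset.mem_coe.1 hi]

lemma indepFun_of_dependsOn {ι : Type*} [Fintype ι] (P : Measure ℝ) [IsProbabilityMeasure P]
    {E F : Type*} [MeasurableSpace E] [MeasurableSpace F]
    {X : (ι → ℝ) → E} {Y : (ι → ℝ) → F} {S T : Set ι} (hST : Disjoint S T)
    (hX : Measurable X) (hY : Measurable Y) (hXS : DependsOn X S) (hYT : DependsOn Y T) :
    IndepFun X Y (Measure.pi fun _ : ι => P) := by
  classical
  have hi : iIndepFun (fun (i : ι) (y : ι → ℝ) => y i) (Measure.pi fun _ : ι => P) :=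
    iIndepFun_pi (X := fun _ => id) fun _ => aemeasurable_id
  have hd : Disjoint S.toFinset T.toFinset := by simpa using hST
  have h := hi.indepFun_finset S.toFinset T.toFinset hd fun i => measurable_pi_apply i
  obtain ⟨φ, hφ, rfl⟩ := exists_eq_comp_restrict_of_dependsOn (S := S.toFinset) hX (by simpa)
  obtain ⟨ψ, hψ, rfl⟩ := exists_eq_comp_restrict_of_dependsOn (S := T.toFinset) hY (by simpa)
  exact h.comp hφ hψ

@[to_additive]
lemma dependsOn_list_map_prod {ι α M : Type*} [Monoid M] (xs : List α) {X : α → (ι → ℝ) → M}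
    {S : α → Set ι} (hX : ∀ a, DependsOn (X a) (S a)) :
    DependsOn (fun y => (xs.map (X · y)).prod) {i | ∃ a ∈ xs, i ∈ S a} := by
  intro y y' h
  refine congrArg List.prod (List.map_congr_left fun a ha => hX a fun i hi => h i ⟨a, ha, hi⟩)

variable {M : Type*} [Monoid M] [MeasurableSpace M]

/-- The law of a product of independent random variables with given laws. -/
@[to_additive /-- The law of a sum of independent random variables with given laws. -/]
def prodLaw (l : List (Measure M)) : Measure M := l.foldr Measure.mconv (Measure.dirac 1)

@[to_additive]
lemma prodLaw_cons (a : Measure M) (l : List (Measure M)) :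
    prodLaw (a :: l) = a.mconv (prodLaw l) := rfl

@[to_additive]
lemma measurable_list_map_prod [MeasurableMul₂ M] {Ω α : Type*} [MeasurableSpace Ω] (xs : List α)
    {X : α → Ω → M} (hX : ∀ a, Measurable (X a)) : Measurable fun y => (xs.map (X · y)).prod := by
  induction xs with
  | nil => exact measurable_const
  | cons a xs ih =>
    simp only [List.map_cons, List.prod_cons]
    exact (hX a).mul ih

@[to_additive]
lemma map_list_map_prod [MeasurableMul₂ M] {ι α : Type*} [Fintype ι] (P : Measure ℝ)
    [IsProbabilityMeasure P] (xs : List α) {X : α → (ι → ℝ) → M}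
    {S : α → Set ι} (hX : ∀ a, Measurable (X a)) (hS : ∀ a, DependsOn (X a) (S a))
    (hd : xs.Pairwise fun a b => Disjoint (S a) (S b)) :
    (Measure.pi fun _ : ι => P).map (fun y => (xs.map (X · y)).prod) =
      prodLaw (xs.map fun a => (Measure.pi fun _ : ι => P).map (X a)) := by
  induction xs with
  | nil => simp [prodLaw]
  | cons a xs ih =>
    rw [List.pairwise_cons] at hd
    have hind := indepFun_of_dependsOn P (S := S a) (T := {i | ∃ b ∈ xs, i ∈ S b}) (by
      rw [Set.disjoint_left]
      rintro i hi ⟨b, hb, hib⟩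
      exact Set.disjoint_left.1 (hd.1 b hb) hi hib) (hX a) (measurable_list_map_prod xs hX)
      (hS a) (dependsOn_list_map_prod xs hS)
    have h := hind.map_mul_eq_map_mconv_map (hX a) (measurable_list_map_prod xs hX)
    rw [ih hd.2] at h
    simp only [List.map_cons, List.prod_cons]
    exact h

end Independence

/-! ### The law of a message on a tree -/

/-- The law of the message sent by a check node, given those of the incoming messages. -/
def chkLaw (l : List (Measure EReal)) : Measure EReal :=
  (prodLaw (l.map fun a => a.map tanhHalf)).map twoArtanh

/-- The law of the message sent by a variable node, given those of the incoming messages. -/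
def varLaw (ch : MBIOSChannel) (l : List (Measure EReal)) : Measure EReal :=
  ch.llrLaw ∗ sumLaw l

/-- The law of the message sent by a variable node after `l` iterations, when its neighbourhood is
a tree of a given shape. The depth `2 * l + 1` counts the visited levels of nodes; the degrees of
the variable nodes on the last level do not matter. -/
def treeLaw (ch : MBIOSChannel) : ∀ l, Shape (2 * l + 1) → Measure EReal
  | 0, _ => ch.llrLaw
  | l + 1, (τ : List (List (Shape (2 * l + 1)))) =>
      varLaw ch (τ.map fun c => chkLaw (c.map (treeLaw ch l)))

lemma treeLaw_succ (ch : MBIOSChannel) (l : ℕ) (τ : List (List (Shape (2 * l + 1)))) :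
    treeLaw ch (l + 1) τ = varLaw ch (τ.map fun c => chkLaw (c.map (treeLaw ch l))) := rfl

namespace DegreeProfile

variable {D : DegreeProfile}

/-- The other sockets of the variable node of a socket. -/
def varOthers (e : D.VarSocket) : List D.VarSocket :=
  (Finset.univ.filter fun e' : D.VarSocket => e'.1 = e.1 ∧ e' ≠ e).toList

/-- The other sockets of the check node of a socket. -/
def chkOthers (s : D.ChkSocket) : List D.ChkSocket :=
  (Finset.univ.filter fun s' : D.ChkSocket => s'.1 = s.1 ∧ s' ≠ s).toList

variable (G : D.TannerGraph)

lemma exploreShape_two_mul_add_three (l : ℕ) (e : D.VarSocket) :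
    exploreShape G (2 * (l + 1) + 1) (.inl e) =
      ((varOthers e).map fun e' => (chkOthers (G e')).map fun s' =>
        exploreShape G (2 * l + 1) (.inl (G.symm s')) : List (List (Shape (2 * l + 1)))) := by
  change List.map _ (List.map Sum.inl (varOthers e)) = _
  rw [List.map_map]
  refine List.map_congr_left fun e' _ => ?_
  change List.map _ (List.map Sum.inr (chkOthers (G e'))) = _
  rw [List.map_map]
  rfl

lemma exploreNodes_two_mul_add_three (l : ℕ) (e : D.VarSocket) :
    exploreNodes G (2 * (l + 1) + 1) (.inl e) =
      .inl e.1 :: (varOthers e).flatMap fun e' => .inr (G e').1 ::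
        (chkOthers (G e')).flatMap fun s' => exploreNodes G (2 * l + 1) (.inl (G.symm s')) := by
  change D.node (Sum.inl e) :: List.flatMap _ (List.map Sum.inl (varOthers e)) = _
  rw [List.flatMap_map, node_inl]
  congr 2
  funext e'
  change D.node (Sum.inr (G e')) :: List.flatMap _ (List.map Sum.inr (chkOthers (G e'))) = _
  rw [List.flatMap_map, node_inr]
  rfl

variable (ch : MBIOSChannel)

lemma varMessage_succ_eq (y : Fin D.numVar → ℝ) (l : ℕ) (e : D.VarSocket) :
    varMessage ch G y (l + 1) e = ch.llr (y e.1) + ((varOthers e).map fun e' =>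
      twoArtanh ((chkOthers (G e')).map fun s' =>
        tanhHalf (varMessage ch G y l (G.symm s'))).prod).sum := by
  rw [varMessage, varOthers, Finset.sum_map_toList]
  congr 1
  refine Finset.sum_congr rfl fun e' _ => ?_
  rw [chkMessage, chkOthers, Finset.prod_map_toList]

lemma measurable_varMessage (l : ℕ) (e : D.VarSocket) :
    Measurable fun y => varMessage ch G y l e := by
  induction l generalizing e with
  | zero => exact ch.measurable_llr.comp (measurable_pi_apply _)
  | succ l ih =>
    simp only [varMessage_succ_eq]
    refine (ch.measurable_llr.comp (measurable_pi_apply _)).add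
      (measurable_list_map_sum _ fun e' => measurable_twoArtanh.comp
        (measurable_list_map_prod _ fun s' => measurable_tanhHalf.comp (ih _)))

/-- The message depends only on the channel outputs at the visited variable nodes. -/
lemma dependsOn_varMessage (l : ℕ) (e : D.VarSocket) :
    DependsOn (fun y => varMessage ch G y l e)
      {v | Sum.inl v ∈ exploreNodes G (2 * l + 1) (.inl e)} := by
  induction l generalizing e with
  | zero =>
    intro y y' h
    have := h e.1 (by simp [exploreNodes])
    simp [varMessage, this]
  | succ l ih =>
    intro y y' h
    simp only [exploreNodes_two_mul_add_three, Set.mem_ofPred_eq, List.mem_cons,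
      List.mem_flatMap] at h
    dsimp only
    rw [varMessage_succ_eq, varMessage_succ_eq, h e.1 (Or.inl rfl)]
    congr 2
    refine List.map_congr_left fun e' he' => ?_
    congr 2
    refine List.map_congr_left fun s' hs' => ?_
    congr 1
    exact ih _ fun v hv => h v (Or.inr ⟨e', he', Or.inr ⟨s', hs', hv⟩⟩)

/-- On a tree the incoming messages of each node are independent. -/
lemma map_varMessage_eq_treeLaw (l : ℕ) (e : D.VarSocket)
    (h : (exploreNodes G (2 * l + 1) (.inl e)).Nodup) :
    (Measure.pi fun _ : Fin D.numVar => ch.outputLaw 0).map (fun y => varMessage ch G y l e) =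
      treeLaw ch l (exploreShape G (2 * l + 1) (.inl e)) := by
  have hllr : ∀ v, (Measure.pi fun _ : Fin D.numVar => ch.outputLaw 0).map
      (fun y => ch.llr (y v)) = ch.llrLaw := by
    intro v
    have hv := (measurePreserving_eval (fun _ : Fin D.numVar => ch.outputLaw 0) v).map_eq
    have hc := Measure.map_map (μ := Measure.pi fun _ : Fin D.numVar => ch.outputLaw 0)
      ch.measurable_llr (measurable_pi_apply v)
    exact hc.symm.trans (congrArg (Measure.map ch.llr) hv)
  induction l generalizing e with
  | zero => exact hllr e.1
  | succ l ih =>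
    rw [exploreNodes_two_mul_add_three, List.nodup_cons, List.nodup_flatMap] at h
    obtain ⟨h1, h2, h3⟩ := h
    rw [exploreShape_two_mul_add_three, treeLaw_succ, varLaw, List.map_map]
    simp only [varMessage_succ_eq]
    set X : D.VarSocket → (Fin D.numVar → ℝ) → EReal := fun e' y =>
      twoArtanh ((chkOthers (G e')).map fun s' =>
        tanhHalf (varMessage ch G y l (G.symm s'))).prod with hXdef
    set Z : D.ChkSocket → (Fin D.numVar → ℝ) → ℝ := fun s' y =>
      tanhHalf (varMessage ch G y l (G.symm s')) with hZdef
    set S : D.VarSocket → Set (Fin D.numVar) := fun e' =>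
      {v | ∃ s' ∈ chkOthers (G e'),
        v ∈ {v | Sum.inl v ∈ exploreNodes G (2 * l + 1) (.inl (G.symm s'))}} with hSdef
    have hZm : ∀ s', Measurable (Z s') := fun s' =>
      measurable_tanhHalf.comp (measurable_varMessage G ch l _)
    have hZS : ∀ s', DependsOn (Z s')
        {v | Sum.inl v ∈ exploreNodes G (2 * l + 1) (.inl (G.symm s'))} :=
      fun s' y y' hy => congrArg tanhHalf (dependsOn_varMessage G ch l _ hy)
    have hXm : ∀ e', Measurable (X e') := fun e' =>
      measurable_twoArtanh.comp (measurable_list_map_prod _ hZm)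
    have hXS : ∀ e', DependsOn (X e') (S e') := fun e' y y' hy =>
      congrArg twoArtanh (dependsOn_list_map_prod (chkOthers (G e')) hZS hy)
    have hXlaw : ∀ e' ∈ varOthers e,
        (Measure.pi fun _ : Fin D.numVar => ch.outputLaw 0).map (X e') =
          chkLaw (((chkOthers (G e')).map fun s' =>
            exploreShape G (2 * l + 1) (.inl (G.symm s'))).map (treeLaw ch l)) := by
      intro e' he'
      have hn := (List.nodup_cons.1 (h2 e' he')).2
      rw [List.nodup_flatMap] at hn
      have hprod := map_list_map_prod (ch.outputLaw 0) (chkOthers (G e')) hZm hZS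
        (hn.2.imp fun {a b} hab => Set.disjoint_left.2 fun v hv hv' => hab hv hv')
      have hcomp : X e' = twoArtanh ∘ fun y => ((chkOthers (G e')).map (Z · y)).prod := rfl
      rw [hcomp, ← Measure.map_map measurable_twoArtanh (measurable_list_map_prod _ hZm), hprod,
        chkLaw, List.map_map, List.map_map]
      congr 2
      refine List.map_congr_left fun s' hs' => ?_
      rw [Function.comp_apply, Function.comp_apply, ← ih _ (hn.1 s' hs'),
        Measure.map_map measurable_tanhHalf (measurable_varMessage G ch l _)]
      rfl
    have hsum := map_list_map_sum (ch.outputLaw 0) (varOthers e) hXm hXS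
      (h3.imp fun {a b} hab => by
        rw [Set.disjoint_left]
        rintro v ⟨s, hs, hv⟩ ⟨s', hs', hv'⟩
        exact hab (List.mem_cons_of_mem _ (List.mem_flatMap.2 ⟨s, hs, hv⟩))
          (List.mem_cons_of_mem _ (List.mem_flatMap.2 ⟨s', hs', hv'⟩)))
    rw [List.map_congr_left hXlaw] at hsum
    have hind := indepFun_of_dependsOn (ch.outputLaw 0) (X := fun y : Fin D.numVar → ℝ =>
      ch.llr (y e.1)) (S := {e.1}) (T := {v | ∃ e' ∈ varOthers e, v ∈ S e'}) (by
        rw [Set.disjoint_singleton_left]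
        rintro ⟨e', he', s', hs', hv⟩
        exact h1 (List.mem_flatMap.2 ⟨e', he', List.mem_cons_of_mem _
          (List.mem_flatMap.2 ⟨s', hs', hv⟩)⟩))
      (ch.measurable_llr.comp (measurable_pi_apply _)) (measurable_list_map_sum _ hXm)
      (fun y y' hy => congrArg ch.llr (hy e.1 rfl)) (dependsOn_list_map_sum _ hXS)
    have hm : Measurable fun y : Fin D.numVar → ℝ => ch.llr (y e.1) :=
      ch.measurable_llr.comp (measurable_pi_apply _)
    have hadd := hind.map_add_eq_map_conv_map hm
      (measurable_list_map_sum _ hXm)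
    rw [hsum, hllr] at hadd
    exact hadd

end DegreeProfile

/-! ### Symmetry and error probability of the messages on a tree -/

/-- At a check node the signs of the incoming messages are multiplied. -/
lemma chkLaw_spec (l : List (Measure EReal)) (hp : ∀ a ∈ l, IsProbabilityMeasure a)
    (hs : ∀ a ∈ l, IsSymmLaw a) :
    IsProbabilityMeasure (chkLaw l) ∧ IsSymmLaw (chkLaw l) ∧
      1 - 2 * lawError (chkLaw l) = (l.map fun a => 1 - 2 * lawError a).prod := by
  have key : IsProbabilityMeasure (prodLaw (l.map fun a => a.map tanhHalf)) ∧
      IsSymmTanhLaw (prodLaw (l.map fun a => a.map tanhHalf)) ∧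
      signMean (prodLaw (l.map fun a => a.map tanhHalf)) =
        (l.map fun a => 1 - 2 * lawError a).prod := by
    induction l with
    | nil =>
      exact ⟨Measure.dirac.isProbabilityMeasure, isSymmTanhLaw_dirac_one, signMean_dirac_one⟩
    | cons a l ih =>
      obtain ⟨h1, h2, h3⟩ := ih (fun b hb => hp b (List.mem_cons_of_mem _ hb))
        fun b hb => hs b (List.mem_cons_of_mem _ hb)
      have := hp a List.mem_cons_self
      have ha := (hs a List.mem_cons_self).map_tanhHalf
      have : IsProbabilityMeasure (a.map tanhHalf) :=
        Measure.isProbabilityMeasure_map measurable_tanhHalf.aemeasurable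
      rw [List.map_cons, prodLaw_cons]
      refine ⟨Measure.probabilitymeasure_of_probabilitymeasures_mconv _ _, ha.mconv h2, ?_⟩
      rw [List.map_cons, List.prod_cons, ← signMean_map_tanhHalf, ← h3]
      exact signMean_mconv _ _
  obtain ⟨h1, h2, h3⟩ := key
  have h4 : IsProbabilityMeasure (chkLaw l) :=
    Measure.isProbabilityMeasure_map measurable_twoArtanh.aemeasurable
  refine ⟨h4, h2.map_twoArtanh, ?_⟩
  rw [← signMean_map_tanhHalf, ← h3, chkLaw, map_tanhHalf_map_twoArtanh h2]

/-- At a variable node independent observations are combined. -/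
lemma varLaw_spec (ch : MBIOSChannel) (l : List (Measure EReal))
    (hp : ∀ a ∈ l, IsProbabilityMeasure a) (hs : ∀ a ∈ l, IsSymmLaw a) :
    IsProbabilityMeasure (varLaw ch l) ∧ IsSymmLaw (varLaw ch l) ∧
      2 * ch.uncodedError * (l.map fun a => 2 * lawError a).prod ≤ 2 * lawError (varLaw ch l) := by
  have key : IsProbabilityMeasure (sumLaw l) ∧ IsSymmLaw (sumLaw l) ∧
      (l.map fun a => 2 * lawError a).prod ≤ 2 * lawError (sumLaw l) := by
    induction l with
    | nil =>
      have h0 : IsProbabilityMeasure (sumLaw ([] : List (Measure EReal))) :=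
        Measure.dirac.isProbabilityMeasure
      have h1 : IsSymmLaw (sumLaw ([] : List (Measure EReal))) := isSymmLaw_dirac_zero
      refine ⟨h0, h1, ?_⟩
      rw [← ENNReal.ofReal_le_ofReal_iff (mul_nonneg zero_le_two (lawError_nonneg _)),
        h1.ofReal_two_mul_lawError, sumLaw, List.foldr_nil, lintegral_dirac,
        minWeight_of_nonpos le_rfl]
      simp
    | cons a l ih =>
      obtain ⟨h1, h2, h3⟩ := ih (fun b hb => hp b (List.mem_cons_of_mem _ hb))
        fun b hb => hs b (List.mem_cons_of_mem _ hb)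
      have := hp a List.mem_cons_self
      have ha := hs a List.mem_cons_self
      rw [sumLaw_cons]
      refine ⟨Measure.probabilitymeasure_of_probabilitymeasures_conv _ _, ha.conv h2, ?_⟩
      refine le_trans ?_ (ha.lawError_conv_ge h2)
      rw [List.map_cons, List.prod_cons]
      exact mul_le_mul_of_nonneg_left h3 (mul_nonneg zero_le_two (lawError_nonneg _))
  obtain ⟨h1, h2, h3⟩ := key
  refine ⟨Measure.probabilitymeasure_of_probabilitymeasures_conv _ _,
    ch.isSymmLaw_llrLaw.conv h2, ?_⟩
  refine le_trans ?_ (ch.isSymmLaw_llrLaw.lawError_conv_ge h2)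
  rw [ch.uncodedError_eq_lawError]
  exact mul_le_mul_of_nonneg_left h3 (mul_nonneg zero_le_two (lawError_nonneg _))

variable (ch : MBIOSChannel)

lemma treeLaw_spec (l : ℕ) (τ : Shape (2 * l + 1)) :
    IsProbabilityMeasure (treeLaw ch l τ) ∧ IsSymmLaw (treeLaw ch l τ) := by
  induction l with
  | zero => exact ⟨inferInstanceAs (IsProbabilityMeasure ch.llrLaw), ch.isSymmLaw_llrLaw⟩
  | succ l ih =>
    have hc : ∀ a ∈ List.map (fun c => chkLaw (List.map (treeLaw ch l) c))
        (τ : List (List (Shape (2 * l + 1)))), IsProbabilityMeasure a ∧ IsSymmLaw a := by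
      intro a ha
      obtain ⟨c, -, rfl⟩ := List.mem_map.1 ha
      have hv : ∀ b ∈ List.map (treeLaw ch l) c, IsProbabilityMeasure b ∧ IsSymmLaw b := by
        intro b hb
        obtain ⟨v, -, rfl⟩ := List.mem_map.1 hb
        exact ih v
      have h := chkLaw_spec _ (fun b hb => (hv b hb).1) fun b hb => (hv b hb).2
      exact ⟨h.1, h.2.1⟩
    have h := varLaw_spec ch _ (fun a ha => (hc a ha).1) fun a ha => (hc a ha).2
    exact ⟨h.1, h.2.1⟩

/-- The error probability of the message sent by a variable node, when its neighbourhood is a tree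
of a given shape. -/
def treeError (l : ℕ) (τ : Shape (2 * l + 1)) : ℝ := lawError (treeLaw ch l τ)

lemma treeError_nonneg (l : ℕ) (τ : Shape (2 * l + 1)) : 0 ≤ treeError ch l τ := lawError_nonneg _

lemma two_mul_treeError_le_one (l : ℕ) (τ : Shape (2 * l + 1)) : 2 * treeError ch l τ ≤ 1 := by
  have := (treeLaw_spec ch l τ).1
  exact (treeLaw_spec ch l τ).2.two_mul_lawError_le_one

/-- Twice the error probability of the message sent by a check node of a tree. -/
def chkTreeError (l : ℕ) (c : List (Shape (2 * l + 1))) : ℝ :=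
  1 - (List.map (fun v => 1 - 2 * treeError ch l v) c).prod

lemma chkTreeError_eq (l : ℕ) (c : List (Shape (2 * l + 1))) :
    chkTreeError ch l c = 2 * lawError (chkLaw (List.map (treeLaw ch l) c)) := by
  have hv : ∀ b ∈ List.map (treeLaw ch l) c, IsProbabilityMeasure b ∧ IsSymmLaw b := by
    intro b hb
    obtain ⟨v, -, rfl⟩ := List.mem_map.1 hb
    exact treeLaw_spec ch l v
  have h := (chkLaw_spec _ (fun b hb => (hv b hb).1) fun b hb => (hv b hb).2).2.2
  rw [List.map_map] at h
  have h' : ((fun a => 1 - 2 * lawError a) ∘ treeLaw ch l) = fun v => 1 - 2 * treeError ch l v :=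
    rfl
  rw [chkTreeError, ← h', ← h]
  ring

lemma prod_one_sub_treeError_nonneg (l : ℕ) (c : List (Shape (2 * l + 1))) :
    0 ≤ (List.map (fun v => 1 - 2 * treeError ch l v) c).prod := by
  refine List.prod_nonneg fun x hx => ?_
  obtain ⟨v, -, rfl⟩ := List.mem_map.1 hx
  linarith [two_mul_treeError_le_one ch l v]

lemma chkTreeError_nonneg (l : ℕ) (c : List (Shape (2 * l + 1))) : 0 ≤ chkTreeError ch l c := by
  rw [chkTreeError_eq]
  exact mul_nonneg zero_le_two (lawError_nonneg _)

lemma chkTreeError_le_one (l : ℕ) (c : List (Shape (2 * l + 1))) : chkTreeError ch l c ≤ 1 := by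
  have := prod_one_sub_treeError_nonneg ch l c
  rw [chkTreeError]
  linarith

lemma treeError_succ_ge (l : ℕ) (τ : List (List (Shape (2 * l + 1)))) :
    2 * ch.uncodedError * (List.map (chkTreeError ch l) τ).prod ≤ 2 * treeError ch (l + 1) τ := by
  have hc : ∀ a ∈ List.map (fun c => chkLaw (List.map (treeLaw ch l) c))
      (τ : List (List (Shape (2 * l + 1)))),
      IsProbabilityMeasure a ∧ IsSymmLaw a := by
    intro a ha
    obtain ⟨c, -, rfl⟩ := List.mem_map.1 ha
    have hv : ∀ b ∈ List.map (treeLaw ch l) c, IsProbabilityMeasure b ∧ IsSymmLaw b := by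
      intro b hb
      obtain ⟨v, -, rfl⟩ := List.mem_map.1 hb
      exact treeLaw_spec ch l v
    have h := chkLaw_spec _ (fun b hb => (hv b hb).1) fun b hb => (hv b hb).2
    exact ⟨h.1, h.2.1⟩
  have h := (varLaw_spec ch _ (fun a ha => (hc a ha).1) fun a ha => (hc a ha).2).2.2
  rw [List.map_map] at h
  refine le_trans (le_of_eq ?_) h
  congr 2
  exact List.map_congr_left fun c _ => chkTreeError_eq ch l c

/-! ### Sums over shapes -/

lemma _root_.HasSum.trans_eq {α : Type*} {f g : α → ℝ} {S : ℝ} (hf : HasSum f S)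
    (h : ∀ a, f a = g a) : HasSum g S := funext h ▸ hf

lemma hasSum_pi_prod {α : Type*} {f : α → ℝ} {S : ℝ} (hf : HasSum f S) (hf0 : ∀ a, 0 ≤ f a)
    (n : ℕ) : HasSum (fun g : Fin n → α => ∏ i, f (g i)) (S ^ n) := by
  induction n with
  | zero => simp
  | succ n ih =>
    have ih0 : 0 ≤ fun g : Fin n → α => ∏ i, f (g i) := fun g =>
      Finset.prod_nonneg fun i _ => hf0 (g i)
    have h := hf.mul ih (Summable.mul_of_nonneg (f := f) (g := fun g : Fin n → α => ∏ i, f (g i))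
      hf.summable ih.summable hf0 ih0)
    let e : α × (Fin n → α) ≃ (Fin (n + 1) → α) :=
      { toFun := fun x => Fin.cons x.1 x.2
        invFun := fun g => (g 0, Fin.tail g)
        left_inv := fun x => rfl
        right_inv := fun g => Fin.cons_self_tail g }
    rw [pow_succ']
    refine e.hasSum_iff.1 (h.trans_eq fun x => ?_)
    exact (Fin.prod_univ_succ fun i => f ((Fin.cons x.1 x.2 : Fin (n + 1) → α) i)).symm

/-- Summing over lists amounts to evaluating a power series. -/
lemma hasSum_list {α : Type*} {f : α → ℝ} {S T : ℝ} {w : ℕ → ℝ} (hf : HasSum f S)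
    (hf0 : ∀ a, 0 ≤ f a) (hw : ∀ n, 0 ≤ w n) (h : HasSum (fun n => w n * S ^ n) T) :
    HasSum (fun τ : List α => w τ.length * (τ.map f).prod) T := by
  rw [← (List.equivSigmaTuple (α := α)).symm.hasSum_iff]
  have hn : ∀ n, HasSum (fun g : Fin n → α => ((fun τ : List α => w τ.length * (τ.map f).prod) ∘
      List.equivSigmaTuple.symm) ⟨n, g⟩) (w n * S ^ n) := by
    intro n
    have := (hasSum_pi_prod hf hf0 n).mul_left (w n)
    simpa [List.equivSigmaTuple, List.map_ofFn, List.prod_ofFn] using this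
  refine HasSum.sigma_of_hasSum h hn ?_
  rw [summable_sigma_of_nonneg]
  · refine ⟨fun n => (hn n).summable, ?_⟩
    simp only [(hn _).tsum_eq]
    exact h.summable
  · intro x
    refine mul_nonneg (hw _) (List.prod_nonneg fun y hy => ?_)
    obtain ⟨a, -, rfl⟩ := List.mem_map.1 hy
    exact hf0 a

lemma DegreeDistribution.hasSum_eval (L : DegreeDistribution) {x : ℝ} (h0 : 0 ≤ x) (h1 : x ≤ 1) :
    HasSum (fun n => L.coeff (n + 1) * x ^ n) (L.eval x) := by
  have hs : Summable fun i => L.coeff i * x ^ (i - 1) :=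
    L.hasSum_coeff.summable.of_nonneg_of_le
      (fun i => mul_nonneg (L.coeff_nonneg i) (pow_nonneg h0 _))
      fun i => mul_le_of_le_one_right (L.coeff_nonneg i) (pow_le_one₀ h0 h1)
  have := (hasSum_nat_add_iff' 1).2 hs.hasSum
  simpa [L.coeff_zero, DegreeDistribution.eval] using this

/-- The degree distributions of the limiting branching process. -/
def degWeight (L R : DegreeDistribution) (b : Bool) (n : ℕ) : ℝ :=
  if b then L.coeff n else R.coeff n

variable (L R : DegreeDistribution)

lemma degWeight_nonneg (b : Bool) (n : ℕ) : 0 ≤ degWeight L R b n := by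
  unfold degWeight
  split_ifs
  exacts [L.coeff_nonneg n, R.coeff_nonneg n]

/-- One generation of the branching process: the mean over the shapes of a product over the subtrees
is a degree generating function evaluated at the mean over one subtree. -/
lemma hasSum_weight_mul_prod {k : ℕ} {b : Bool} {g : Shape k → ℝ} {x : ℝ} (hg : ∀ c, 0 ≤ g c)
    (h : HasSum (fun c => Shape.weight (degWeight L R) (!b) k c * g c) x) (hx : x ≤ 1) :
    HasSum (fun τ : List (Shape k) => Shape.weight (degWeight L R) b (k + 1) τ * (τ.map g).prod)
      (if b then L.eval x else R.eval x) := by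
  have h0 : ∀ c, 0 ≤ Shape.weight (degWeight L R) (!b) k c * g c := fun c =>
    mul_nonneg (Shape.weight_nonneg (degWeight_nonneg L R) _ _ _) (hg c)
  have hx0 : 0 ≤ x := h.nonneg h0
  have hsum : HasSum (fun n => degWeight L R b (n + 1) * x ^ n)
      (if b then L.eval x else R.eval x) := by
    cases b
    · simpa [degWeight] using R.hasSum_eval hx0 hx
    · simpa [degWeight] using L.hasSum_eval hx0 hx
  have := hasSum_list (w := fun n => degWeight L R b (n + 1)) h h0
    (fun n => degWeight_nonneg L R b _) hsum
  refine this.trans_eq fun τ => ?_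
  exact (congrArg (degWeight L R b (τ.length + 1) * ·) List.prod_map_mul).trans
    (mul_assoc _ _ _).symm

lemma DegreeDistribution.eval_one : L.eval 1 = 1 := by
  simpa [DegreeDistribution.eval] using L.hasSum_coeff.tsum_eq

/-- No mass is lost in the branching process. -/
lemma hasSum_weight (b : Bool) (k : ℕ) : HasSum (Shape.weight (degWeight L R) b k) 1 := by
  induction k generalizing b with
  | zero => exact hasSum_unique (α := ℝ) (β := Unit) fun _ => 1
  | succ k ih =>
    have h := hasSum_weight_mul_prod L R (b := b) (g := fun _ => 1) (fun _ => zero_le_one)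
      (by simpa using ih (!b)) le_rfl
    rw [DegreeDistribution.eval_one, DegreeDistribution.eval_one, ite_self] at h
    exact h.trans_eq fun τ => by simp

/-- The limit of the error probabilities, as an average over the shape of the neighbourhood. -/
def limitError (l : ℕ) : ℝ :=
  ∑' τ, Shape.weight (degWeight L R) true (2 * l + 1) τ * treeError ch l τ

lemma hasSum_limitError (l : ℕ) :
    HasSum (fun τ => Shape.weight (degWeight L R) true (2 * l + 1) τ * treeError ch l τ)
      (limitError ch L R l) := by
  refine Summable.hasSum ((hasSum_weight L R true (2 * l + 1)).summable.of_nonneg_of_le ?_ ?_)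
  · exact fun τ => mul_nonneg (Shape.weight_nonneg (degWeight_nonneg L R) _ _ _)
      (treeError_nonneg ch l τ)
  · refine fun τ => mul_le_of_le_one_right (Shape.weight_nonneg (degWeight_nonneg L R) _ _ _) ?_
    linarith [two_mul_treeError_le_one ch l τ, treeError_nonneg ch l τ]

lemma limitError_zero : limitError ch L R 0 = ch.uncodedError := by
  have h := (hasSum_weight L R true (2 * 0 + 1)).mul_right ch.uncodedError
  rw [one_mul, ch.uncodedError_eq_lawError] at h
  rw [ch.uncodedError_eq_lawError]
  exact h.tsum_eq

lemma limitError_succ_ge (l : ℕ) :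
    2 * ch.uncodedError * L.eval (1 - R.eval (1 - 2 * limitError ch L R l)) ≤
      2 * limitError ch L R (l + 1) := by
  have hw := fun b k => hasSum_weight L R b k
  have hw0 : ∀ b k τ, 0 ≤ Shape.weight (degWeight L R) b k τ := fun b k τ =>
    Shape.weight_nonneg (degWeight_nonneg L R) b k τ
  -- The mean sign of a message arriving at a check node.
  have hv : HasSum (fun v => Shape.weight (degWeight L R) (!false) (2 * l + 1) v *
      (1 - 2 * treeError ch l v)) (1 - 2 * limitError ch L R l) := by
    refine ((hw true (2 * l + 1)).sub
      ((hasSum_limitError ch L R l).mul_left 2)).trans_eq fun v => ?_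
    rw [Bool.not_false]
    ring
  have hvx : 1 - 2 * limitError ch L R l ≤ 1 := by
    have := (hasSum_limitError ch L R l).nonneg fun τ =>
      mul_nonneg (hw0 _ _ τ) (treeError_nonneg ch l τ)
    linarith
  -- The error probability of a message leaving a check node.
  have hc : HasSum (fun c => Shape.weight (degWeight L R) (!true) (2 * l + 2) c *
      chkTreeError ch l c) (1 - R.eval (1 - 2 * limitError ch L R l)) := by
    have h := hasSum_weight_mul_prod L R (b := false)
      (fun v => by linarith [two_mul_treeError_le_one ch l v]) hv hvx
    refine ((hw false (2 * l + 2)).sub h).trans_eq fun c => ?_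
    exact (mul_one_sub _ _).symm
  have hcx : 1 - R.eval (1 - 2 * limitError ch L R l) ≤ 1 :=
    hasSum_le (fun c : Shape (2 * l + 2) => mul_le_of_le_one_right (hw0 (!true) _ c)
      (chkTreeError_le_one ch l c)) hc (hw (!true) (2 * l + 2))
  have hτ := hasSum_weight_mul_prod L R (k := 2 * l + 2) (b := true)
    (g := chkTreeError ch l) (chkTreeError_nonneg ch l) hc hcx
  refine hasSum_le (fun τ => ?_) (hτ.mul_left (2 * ch.uncodedError))
    ((hasSum_limitError ch L R (l + 1)).mul_left 2)
  have h := mul_le_mul_of_nonneg_left (treeError_succ_ge ch l τ) (hw0 true (2 * l + 3) τ)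
  exact (mul_left_comm _ _ _).trans_le (h.trans_eq (mul_left_comm _ _ _))

/-! ### Convergence along the ensemble -/

section Convergence

open DegreeProfile

lemma signError_le_one {Ω : Type*} [MeasurableSpace Ω] (μ : Measure Ω) [IsProbabilityMeasure μ]
    {M : Ω → EReal} (hM : Measurable M) : signError μ M ≤ 1 := by
  have hn : MeasurableSet {ω | M ω < 0} := measurableSet_lt hM measurable_const
  have hz : MeasurableSet {ω | M ω = 0} := measurableSet_eq_fun hM measurable_const
  have h : μ.real ({ω | M ω < 0} ∪ {ω | M ω = 0}) = _ := measureReal_union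
    (Set.disjoint_left.2 fun ω (h : M ω < 0) (h' : M ω = 0) => h.ne h') hz
  have h1 : μ.real ({ω | M ω < 0} ∪ {ω | M ω = 0}) ≤ 1 := measureReal_le_one
  have h2 : 0 ≤ μ.real {ω | M ω = 0} := measureReal_nonneg
  unfold signError
  linarith

lemma edgeError_of_isTreeOfShape {D : DegreeProfile} {G : D.TannerGraph} {l : ℕ}
    {τ : Shape (2 * l + 1)} {e : D.VarSocket} (h : IsTreeOfShape G τ e) :
    edgeError ch G l e = treeError ch l τ := by
  rw [edgeError, signError_eq_lawError (measurable_varMessage G ch l e),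
    map_varMessage_eq_treeLaw G ch l e h.2, h.1, treeError]

lemma card_tannerGraph_pos (D : DegreeProfile) : 0 < Fintype.card D.TannerGraph := by
  have : Nonempty D.TannerGraph := ⟨Fintype.equivOfCardEq card_chkSocket.symm⟩
  exact Fintype.card_pos

/-- Lower bound for the average over all graphs and edges of a nonnegative quantity that is
determined by the shape of the neighbourhood wherever this is a tree. -/
lemma average_ge {D : DegreeProfile} (hN : 0 < D.numEdges) {k : ℕ}
    {X : D.TannerGraph → D.VarSocket → ℝ} {x : Shape (k + 1) → ℝ} (hX : ∀ G e, 0 ≤ X G e)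
    (hx : ∀ τ, 0 ≤ x τ) (hXx : ∀ G τ e, IsTreeOfShape G τ e → X G e = x τ)
    (F : Finset (Shape (k + 1))) :
    ∑ τ ∈ F, Shape.weight (D.reducedFraction (∑ τ ∈ F, Shape.size (k + 1) τ)) true (k + 1) τ * x τ ≤
      (∑ G, ∑ e, X G e) / (Fintype.card D.TannerGraph * Fintype.card D.VarSocket) := by
  classical
  have hpos : (0 : ℝ) < Fintype.card D.TannerGraph * Fintype.card D.VarSocket := by
    have := card_tannerGraph_pos D
    have : 0 < Fintype.card D.VarSocket := hN
    positivity
  rw [le_div_iff₀ hpos, Finset.sum_mul]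
  have h1 : ∀ τ ∈ F, Shape.weight (D.reducedFraction (∑ τ ∈ F, Shape.size (k + 1) τ)) true (k + 1) τ
      * x τ * (Fintype.card D.TannerGraph * Fintype.card D.VarSocket) ≤
      ∑ G : D.TannerGraph, ∑ e : D.VarSocket, if IsTreeOfShape G τ e then x τ else 0 := by
    intro τ hτ
    have h := card_isTreeOfShape_ge hN τ
      (Finset.single_le_sum (f := Shape.size (k + 1)) (fun _ _ => Nat.zero_le _) hτ)
    have h' := mul_le_mul_of_nonneg_right h (hx τ)
    refine (le_of_eq (by ring)).trans (h'.trans (le_of_eq ?_))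
    rw [Finset.sum_comm, Finset.sum_mul]
    refine Finset.sum_congr rfl fun e _ => ?_
    rw [← Finset.sum_filter, Finset.sum_const, nsmul_eq_mul, graphCount]
  refine (Finset.sum_le_sum h1).trans ?_
  rw [Finset.sum_comm]
  refine Finset.sum_le_sum fun G _ => ?_
  rw [Finset.sum_comm]
  refine Finset.sum_le_sum fun e _ => ?_
  -- The neighbourhood has only one shape.
  by_cases h : ∃ τ ∈ F, IsTreeOfShape G τ e
  · obtain ⟨τ, hτ, hG⟩ := h
    rw [Finset.sum_eq_single_of_mem τ hτ, if_pos hG, hXx G τ e hG]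
    intro τ' _ hne
    exact if_neg fun hG' => hne (hG'.1.symm.trans hG.1)
  · rw [Finset.sum_eq_zero]
    · exact hX G e
    · exact fun τ hτ => if_neg fun hG => h ⟨τ, hτ, hG⟩

variable {L R} {D : ℕ → DegreeProfile}

lemma IsEnsemble.tendsto_numEdges (hD : IsEnsemble L R D) :
    Tendsto (fun j => ((D j).numEdges : ℝ)) atTop atTop := by
  refine tendsto_natCast_atTop_atTop.comp (tendsto_atTop_mono (fun j => ?_) hD.length_tendsto)
  rw [numEdges, Fintype.card_sigma]
  calc (D j).numVar = ∑ _v : Fin (D j).numVar, 1 := by simp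
    _ ≤ _ := Finset.sum_le_sum fun v _ => by
        simpa using Nat.succ_le_of_lt ((D j).varDeg_pos v)

lemma IsEnsemble.tendsto_reducedFraction (hD : IsEnsemble L R D) (K : ℕ) (b : Bool) (n : ℕ) :
    Tendsto (fun j => (D j).reducedFraction K b n) atTop (𝓝 (degWeight L R b n)) := by
  have h1 : Tendsto (fun j => (D j).edgeFraction b n) atTop (𝓝 (degWeight L R b n)) := by
    cases b
    · simpa [edgeFraction, degWeight] using hD.chk_tendsto n
    · simpa [edgeFraction, degWeight] using hD.var_tendsto n
  have h2 : Tendsto (fun j => (K * n : ℝ) / (D j).numEdges) atTop (𝓝 0) :=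
    hD.tendsto_numEdges.const_div_atTop _
  have h3 := (tendsto_const_nhds (x := (0 : ℝ))).max (h1.sub h2)
  rwa [sub_zero, max_eq_right (degWeight_nonneg L R b n)] at h3

/-- Fatou's lemma for averages over the ensemble. -/
lemma IsEnsemble.eventually_lt_average (hD : IsEnsemble L R D) {k : ℕ}
    {X : ∀ j, (D j).TannerGraph → (D j).VarSocket → ℝ} {x : Shape (k + 1) → ℝ}
    (hX : ∀ j G e, 0 ≤ X j G e) (hx : ∀ τ, 0 ≤ x τ)
    (hXx : ∀ j G τ e, IsTreeOfShape G τ e → X j G e = x τ) {S a : ℝ}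
    (hS : HasSum (fun τ => Shape.weight (degWeight L R) true (k + 1) τ * x τ) S) (ha : a < S) :
    ∀ᶠ j in atTop, a < (∑ G, ∑ e, X j G e) /
      (Fintype.card (D j).TannerGraph * Fintype.card (D j).VarSocket) := by
  obtain ⟨F, hF⟩ := ((tendsto_order.1 hS).1 a ha).exists
  have hlim := tendsto_finsetSum F fun τ _ => (Shape.tendsto_weight
    (hD.tendsto_reducedFraction (∑ τ ∈ F, Shape.size (k + 1) τ)) true (k + 1) τ).mul_const (x τ)
  filter_upwards [(tendsto_order.1 hlim).1 a hF, hD.tendsto_numEdges.eventually_gt_atTop 0]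
    with j hj hN
  exact hj.trans_le (average_ge (by exact_mod_cast hN) (hX j) hx (hXx j) F)

lemma IsEnsemble.tendsto_avgError (hD : IsEnsemble L R D) (l : ℕ) :
    Tendsto (fun j => avgError ch (D j) l) atTop (𝓝 (limitError ch L R l)) := by
  rw [tendsto_order]
  constructor
  · intro a ha
    exact hD.eventually_lt_average (X := fun j G e => edgeError ch G l e)
      (fun j G e => by unfold edgeError signError; positivity) (treeError_nonneg ch l)
      (fun j G τ e h => edgeError_of_isTreeOfShape ch h) (hasSum_limitError ch L R l) ha
  -- The upper bound is the lower bound for the probability of a correct decision.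
  · intro a ha
    have hS : HasSum (fun τ => Shape.weight (degWeight L R) true (2 * l + 1) τ *
        (1 - treeError ch l τ)) (1 - limitError ch L R l) := by
      refine ((hasSum_weight L R true (2 * l + 1)).sub
        (hasSum_limitError ch L R l)).trans_eq fun τ => ?_
      ring
    have h := hD.eventually_lt_average (X := fun j G e => 1 - edgeError ch G l e)
      (x := fun τ => 1 - treeError ch l τ)
      (fun j G e => sub_nonneg.2 (signError_le_one _ (measurable_varMessage G ch l e)))
      (fun τ => by linarith [two_mul_treeError_le_one ch l τ, treeError_nonneg ch l τ])
      (fun j G τ e h => by rw [edgeError_of_isTreeOfShape ch h]) hS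
      (a := 1 - a) (by linarith)
    filter_upwards [h, hD.tendsto_numEdges.eventually_gt_atTop 0] with j hj hN
    have hpos : (0 : ℝ) < Fintype.card (D j).TannerGraph * Fintype.card (D j).VarSocket := by
      have := card_tannerGraph_pos (D j)
      have : 0 < Fintype.card (D j).VarSocket := by exact_mod_cast hN
      positivity
    have havg : (∑ G : (D j).TannerGraph, ∑ e : (D j).VarSocket, (1 - edgeError ch G l e)) /
        (Fintype.card (D j).TannerGraph * Fintype.card (D j).VarSocket) =
        1 - avgError ch (D j) l := by
      rw [avgError, eq_sub_iff_add_eq, ← add_div, div_eq_one_iff_eq hpos.ne']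
      simp [Finset.sum_sub_distrib]
    rw [havg] at hj
    linarith

end Convergence

end LDPC

end

theorem mainTheorem2 (ch : LDPC.MBIOSChannel) (L R : LDPC.DegreeDistribution) :
    ∃ P : ℕ → ℝ,
      (∀ D : ℕ → LDPC.DegreeProfile, LDPC.IsEnsemble L R D →
        ∀ l, Filter.Tendsto (fun k => LDPC.avgError ch (D k) l) Filter.atTop (nhds (P l))) ∧
      P 0 = ch.uncodedError ∧
      ∀ l, 1 ≤ l →
        2 * P l ≥ 2 * ch.uncodedError * L.eval (1 - R.eval (1 - 2 * P (l - 1))) := by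
  refine ⟨LDPC.limitError ch L R, fun D hD l => hD.tendsto_avgError ch l,
    LDPC.limitError_zero ch L R, fun l hl => ?_⟩
  obtain ⟨l, rfl⟩ := Nat.exists_eq_add_of_le' hl
  exact LDPC.limitError_succ_ge ch L R l
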